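/- **Definitions.** A represented space is a set $X$ with a surjective partial map $\delta_X:\subseteq\mathbb N^{\mathbb N}\to X$; $p$ is a name of $\delta_X(p)$, and a point is computable if it has a computable name. A partial function $F:\subseteq\mathbb N^{\mathbb N}\to\mathbb N^{\mathbb N}$ realizes a partial multi-valued function $f:\subseteq X\rightrightarrows Y$, written $F\vdash f$, if $\delta_YF(p)\in f(\delta_X(p))$ for every $p$ with $\delta_X(p)\in\operatorname{dom} f$. For multi-valued functions $f,g$ on represented spaces, $f\le_W g$ means that there are computable partial functions $K,H:\subseteq\mathbb N^{\mathbb N}\to\mathbb N^{\mathbb N}$ such that $K\langle \mathrm{id},GH\rangle\vdash f$ for all $G\vdash g$; $f\equiv_W g$ means $f\le_W g$ and $g\le_W f$; $f<_W g$ means $f\le_W g$ and $g\not\le_W f$. A multi-valued function $f$ is non-uniformly computable if for every computable $x\in\operatorname{dom} f$ the set $f(x)$ contains a computable point. Let $X$ be $[0,1]$ or $[0,1]^n$ with the maximum metric ($[0,1]^0$ is a one-point space), with the Cauchy representation given by the rational points. Let $\mathcal A_-(X)$ be the space of closed subsets of $X$, where a name of $A$ is a sequence $p$ with $A=X\setminus\bigcup_i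 B_{p(i)}$, for a standard enumeration $(B_k)_k$ of the open balls with rational centers and radii. The computable points of $\mathcal A_-(X)$ are the co-c.e. closed sets. Closed choice $\mathsf C_{[0,1]}:\subseteq\mathcal A_-([0,1])\rightrightarrows[0,1]$, $A\mapsto A$, is defined on the non-empty closed sets; connected choice $\mathsf{ConC}_n:\subseteq\mathcal A_-([0,1]^n)\rightrightarrows[0,1]^n$, $A\mapsto A$, is defined on the non-empty connected closed sets. **Proposition.** For all $n\ge 3$, $$\mathsf{ConC}_0<_W\mathsf{ConC}_1<_W\mathsf{ConC}_2\le_W\mathsf{ConC}_n\equiv_W\mathsf C_{[0,1]}.$$ Moreover, there is a non-empty co-c.e. closed set $A\subseteq[0,1]$ such that $M(A):=(A\times[0,1])\cup([0,1]\times A)$ is a connected co-c.e. closed subset of $[0,1]^2$ that contains no computable point, whereas $\mathsf{ConC}_1$ is non-uniformly computable. -/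

import Mathlib

open Set Topology

noncomputable section

namespace WeihrauchLattice

/-! ### Computability on Baire space -/

/-- Baire space `ℕ^ℕ`. -/
abbrev Baire : Type := ℕ → ℕ

/-- The finite initial segment `p(0), …, p(n-1)` of `p`. -/
def initSeg (p : Baire) (n : ℕ) : List ℕ := (List.range n).map p

/-- A partial function `F :⊆ ℕ^ℕ → ℕ^ℕ` is computable if there is a (total) computable function `h`
on finite words, monotone for the prefix order, which approximates it: for every `p ∈ dom F`, the
words `h (p(0) … p(m-1))` are initial segments of `F p`, of unbounded length. As usual, an algorithm
for `F` has to be correct on `dom F` and may do anything on other inputs. -/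
def ComputableFun (F : Baire →. Baire) : Prop :=
  ∃ h : List ℕ → List ℕ, Computable h ∧ (∀ u v, u <+: v → h u <+: h v) ∧
    ∀ p, ∀ q ∈ F p,
      (∀ m, ∃ n, h (initSeg p m) = initSeg q n) ∧
      (∀ n, ∃ m, initSeg q n <+: h (initSeg p m))

/-- The standard pairing `⟨p, q⟩(2n) = p(n)`, `⟨p, q⟩(2n+1) = q(n)`. -/
def pair (p q : Baire) : Baire := fun n => if n % 2 = 0 then p (n / 2) else q (n / 2)

/-! ### Represented spaces, realizers, Weihrauch reducibility -/

/-- A represented space: a set with a surjective partial map from Baire space onto it. -/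
class RepresentedSpace (X : Type) where
  /-- the representation; `x ∈ rep p` means that `p` is a name of `x` -/
  rep : Baire →. X
  surjective : ∀ x, ∃ p, x ∈ rep p

open RepresentedSpace

/-- A point is computable if it has a computable name. -/
def IsComputablePoint {X : Type} [RepresentedSpace X] (x : X) : Prop :=
  ∃ p : Baire, Computable p ∧ x ∈ rep p

/-- A partial multi-valued function `X ⇉ Y`; its domain is the set of `x` with nonempty value. -/
abbrev MultiFun (X Y : Type) : Type := X → Set Y

/-- `F ⊢ f`: for every name `p` of a point `x ∈ dom f`, the value `F p` is defined and is a name of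
some `y ∈ f x`. -/
def Realizes {X Y : Type} [RepresentedSpace X] [RepresentedSpace Y]
    (F : Baire →. Baire) (f : MultiFun X Y) : Prop :=
  ∀ p, ∀ x ∈ rep (X := X) p, (f x).Nonempty → ∃ q ∈ F p, ∃ y ∈ rep (X := Y) q, y ∈ f x

/-- The partial function `K⟨id, GH⟩`. -/
def sandwich (K G H : Baire →. Baire) : Baire →. Baire :=
  fun p => (H p).bind fun r => (G r).bind fun q => K (pair p q)

/-- Weihrauch reducibility `f ≤_W g`. -/
def WLE {X Y Z W : Type} [RepresentedSpace X] [RepresentedSpace Y]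
    [RepresentedSpace Z] [RepresentedSpace W] (f : MultiFun X Y) (g : MultiFun Z W) : Prop :=
  ∃ K H : Baire →. Baire, ComputableFun K ∧ ComputableFun H ∧
    ∀ G : Baire →. Baire, Realizes G g → Realizes (sandwich K G H) f

/-- Strict Weihrauch reducibility `f <_W g`. -/
def WLT {X Y Z W : Type} [RepresentedSpace X] [RepresentedSpace Y]
    [RepresentedSpace Z] [RepresentedSpace W] (f : MultiFun X Y) (g : MultiFun Z W) : Prop :=
  WLE f g ∧ ¬ WLE g f

/-- Weihrauch equivalence `f ≡_W g`. -/
def WEquiv {X Y Z W : Type} [RepresentedSpace X] [RepresentedSpace Y]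
    [RepresentedSpace Z] [RepresentedSpace W] (f : MultiFun X Y) (g : MultiFun Z W) : Prop :=
  WLE f g ∧ WLE g f

/-- `f` is non-uniformly computable: every computable point of its domain has a computable value. -/
def NonuniformlyComputable {X Y : Type} [RepresentedSpace X] [RepresentedSpace Y]
    (f : MultiFun X Y) : Prop :=
  ∀ x, IsComputablePoint x → (f x).Nonempty → ∃ y ∈ f x, IsComputablePoint y

/-! ### Metric spaces with a distinguished dense sequence -/

/-- A metric space with a distinguished dense sequence. -/
class DenseSequence (X : Type) [MetricSpace X] where
  pt : ℕ → X
  dense : DenseRange pt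

open DenseSequence

/-- The total enumeration `⟨a, b⟩ ↦ a / (b + 1)` of the nonnegative rational numbers. -/
def nnRat (k : ℕ) : ℝ := (k.unpair.1 : ℝ) / ((k.unpair.2 : ℝ) + 1)

theorem nnRat_nonneg (k : ℕ) : 0 ≤ nnRat k := by unfold nnRat; positivity

theorem nnRat_pair (a b : ℕ) : nnRat (Nat.pair a b) = (a : ℝ) / ((b : ℝ) + 1) := by
  simp [nnRat]

section

variable {X : Type} [MetricSpace X] [DenseSequence X]

/-- `p` is a Cauchy name of `x`: a sequence of indices of points of the dense sequence that
converges to `x` and satisfies `d(p_i, p_j) ≤ 2^{-i}` for `i < j`. -/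
def IsCauchyName (p : Baire) (x : X) : Prop :=
  (∀ i j, i < j → dist (pt (p i) : X) (pt (p j)) ≤ (1 / 2 : ℝ) ^ i) ∧
    Filter.Tendsto (fun i => (pt (p i) : X)) Filter.atTop (𝓝 x)

variable (X) in
/-- The Cauchy representation, as a partial map. -/
def cauchyMap : Baire →. X := fun p => ⟨∃ x : X, IsCauchyName p x, fun h => h.choose⟩

theorem mem_cauchyMap (p : Baire) (x : X) : x ∈ cauchyMap X p ↔ IsCauchyName p x := by
  constructor
  · rintro ⟨h, rfl⟩
    exact h.choose_spec
  · intro hx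
    have h : ∃ x : X, IsCauchyName p x := ⟨x, hx⟩
    exact ⟨h, tendsto_nhds_unique h.choose_spec.2 hx.2⟩

theorem exists_isCauchyName (x : X) : ∃ p, IsCauchyName p x := by
  have h : ∀ i : ℕ, ∃ k, dist x (pt k : X) < (1 / 2 : ℝ) ^ i / 2 := fun i =>
    DenseSequence.dense.exists_dist_lt x (by positivity)
  choose p hp using h
  refine ⟨p, fun i j hij => ?_, ?_⟩
  · have h1 := hp i
    have h2 := hp j
    have h3 : (1 / 2 : ℝ) ^ j ≤ (1 / 2 : ℝ) ^ i :=
      pow_le_pow_of_le_one (by norm_num) (by norm_num) hij.le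
    have h4 := dist_triangle_left (pt (p i) : X) (pt (p j)) x
    linarith
  · rw [tendsto_iff_dist_tendsto_zero]
    refine squeeze_zero (fun _ => dist_nonneg) (fun i => ?_)
      (tendsto_pow_atTop_nhds_zero_of_lt_one (r := (1 / 2 : ℝ)) (by norm_num) (by norm_num))
    have h1 := hp i
    rw [dist_comm]
    have h2 : (0 : ℝ) < (1 / 2 : ℝ) ^ i := by positivity
    linarith

instance cauchyRepresentation : RepresentedSpace X where
  rep := cauchyMap X
  surjective x := by
    obtain ⟨p, hp⟩ := exists_isCauchyName x
    exact ⟨p, (mem_cauchyMap p x).2 hp⟩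

variable (X) in
/-- The standard enumeration of the open balls with center in the dense sequence and nonnegative
rational radius (balls of radius `0` are empty). -/
def basicBall (k : ℕ) : Set X := Metric.ball (pt k.unpair.1) (nnRat k.unpair.2)

variable (X) in
/-- Negative information on closed sets: `p` names the complement of `⋃ i, B_{p(i)}`. -/
def negMap (p : Baire) : TopologicalSpace.Closeds X :=
  ⟨(⋃ i, basicBall X (p i))ᶜ,
    (isOpen_iUnion fun _ => Metric.isOpen_ball).isClosed_compl⟩

theorem negMap_surjective : Function.Surjective (negMap X) := by
  intro A
  have hne : {k | Disjoint (basicBall X k) (A : Set X)}.Nonempty := by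
    refine ⟨Nat.pair 0 (Nat.pair 0 0), ?_⟩
    simp [basicBall, nnRat]
  obtain ⟨p, hp⟩ := (Set.to_countable {k | Disjoint (basicBall X k) (A : Set X)}).exists_eq_range hne
  refine ⟨p, ?_⟩
  apply TopologicalSpace.Closeds.ext
  change (⋃ i, basicBall X (p i))ᶜ = (A : Set X)
  ext x
  rw [mem_compl_iff, mem_iUnion, not_exists]
  constructor
  · intro hx
    by_contra hxA
    obtain ⟨ε, hε, hball⟩ := Metric.isOpen_iff.1 A.isClosed.isOpen_compl x hxA
    obtain ⟨b, hb⟩ := exists_nat_one_div_lt (show 0 < ε / 2 by positivity)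
    have hb0 : (0 : ℝ) < 1 / ((b : ℝ) + 1) := by positivity
    obtain ⟨k, hk⟩ := (DenseSequence.dense (X := X)).exists_dist_lt x hb0
    have hr : nnRat (Nat.pair 1 b) = 1 / ((b : ℝ) + 1) := by rw [nnRat_pair]; simp
    have hmem : Nat.pair k (Nat.pair 1 b) ∈ {k | Disjoint (basicBall X k) (A : Set X)} := by
      change Disjoint _ _
      rw [Set.disjoint_left]
      intro y hy
      simp only [basicBall, Nat.unpair_pair, Metric.mem_ball, hr] at hy
      apply hball
      rw [Metric.mem_ball]
      have := dist_triangle_right y x (pt k)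
      linarith
    rw [hp] at hmem
    obtain ⟨i, hi⟩ := hmem
    apply hx i
    rw [hi]
    simpa [basicBall, hr] using hk
  · intro hxA i hxi
    have : p i ∈ {k | Disjoint (basicBall X k) (A : Set X)} := hp ▸ mem_range_self i
    exact (Set.disjoint_left.1 this) hxi hxA

/-- The represented space `𝒜₋(X)` of closed subsets of `X`, given by negative information. Its
computable points are the co-c.e. closed sets. -/
instance negRepresentation : RepresentedSpace (TopologicalSpace.Closeds X) where
  rep := fun p => Part.some (negMap X p)
  surjective A := by
    obtain ⟨p, hp⟩ := negMap_surjective A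
    exact ⟨p, by simp [hp]⟩

variable (X) in
/-- Closed choice `C_X`: `A ↦ A`, with the nonempty closed sets as domain. -/
def closedChoice : MultiFun (TopologicalSpace.Closeds X) X := fun A => (A : Set X)

end

/-! ### The unit interval and the unit cubes -/

/-- The enumeration `k ↦ min(1, q_k)` of the rational points of `[0,1]`. -/
def ratPoint (k : ℕ) : unitInterval :=
  ⟨min 1 (nnRat k), le_min zero_le_one (nnRat_nonneg k), min_le_left _ _⟩

theorem denseRange_ratPoint : DenseRange ratPoint := by
  rw [Metric.denseRange_iff]
  intro x ε hε
  obtain ⟨b, hb⟩ := exists_nat_one_div_lt hε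
  have hb0 : (0 : ℝ) < (b : ℝ) + 1 := by positivity
  refine ⟨Nat.pair ⌊(x : ℝ) * ((b : ℝ) + 1)⌋₊ b, ?_⟩
  have h1 := Nat.floor_le (mul_nonneg x.2.1 hb0.le)
  have h2 := Nat.lt_floor_add_one ((x : ℝ) * ((b : ℝ) + 1))
  have h3 : (⌊(x : ℝ) * ((b : ℝ) + 1)⌋₊ : ℝ) / ((b : ℝ) + 1) ≤ x := by
    rw [div_le_iff₀ hb0]; exact h1
  have h4 : (x : ℝ) < (⌊(x : ℝ) * ((b : ℝ) + 1)⌋₊ : ℝ) / ((b : ℝ) + 1) + 1 / ((b : ℝ) + 1) := by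
    rw [← add_div, lt_div_iff₀ hb0]; exact h2
  rw [Subtype.dist_eq]
  simp only [ratPoint, nnRat_pair]
  rw [min_eq_right (h3.trans x.2.2), Real.dist_eq, abs_of_nonneg (by linarith)]
  linarith

instance : DenseSequence unitInterval where
  pt := ratPoint
  dense := denseRange_ratPoint

/-- The cube `[0,1]^n`, with the maximum metric; `[0,1]^0` is a one-point space. -/
abbrev Cube (n : ℕ) : Type := Fin n → unitInterval

/-- The enumeration of the rational points of `[0,1]^n`: the number `k` codes a finite list of
natural numbers, whose first `n` entries (with default `0`) are the indices of the coordinates. -/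
def ratCubePoint (n k : ℕ) : Cube n :=
  fun i => ratPoint ((Denumerable.ofNat (List ℕ) k).getD i 0)

theorem denseRange_ratCubePoint (n : ℕ) : DenseRange (ratCubePoint n) := by
  rw [Metric.denseRange_iff]
  intro x ε hε
  have h : ∀ i, ∃ k, dist (x i) (ratPoint k) < ε := fun i =>
    denseRange_ratPoint.exists_dist_lt (x i) hε
  choose f hf using h
  refine ⟨Encodable.encode (List.ofFn f), ?_⟩
  rw [dist_pi_lt_iff hε]
  intro i
  simpa [ratCubePoint] using hf i

instance (n : ℕ) : DenseSequence (Cube n) where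
  pt := ratCubePoint n
  dense := denseRange_ratCubePoint n

/-- Connected choice `ConC_n` of dimension `n`: `A ↦ A`, with the nonempty connected closed subsets
of `[0,1]^n` as domain. -/
def connectedChoice (n : ℕ) : MultiFun (TopologicalSpace.Closeds (Cube n)) (Cube n) :=
  fun A => {x | IsConnected (A : Set (Cube n)) ∧ x ∈ A}

/-- The mixed cube `M(A) = (A × [0,1]) ∪ ([0,1] × A)`. -/
def mixedCube (A : TopologicalSpace.Closeds unitInterval) : TopologicalSpace.Closeds (Cube 2) :=
  ⟨{x | x 0 ∈ A ∨ x 1 ∈ A},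
    (A.isClosed.preimage (continuous_apply 0)).union (A.isClosed.preimage (continuous_apply 1))⟩

end WeihrauchLattice

end

open WeihrauchLattice

/-! All positive reductions but one pull closed sets back along a continuous map `f` with computable
modulus and computable approximations at the dense points (`EffectiveMap`). Given a list of balls
removed from the target, one lists the balls of the source that verifiably map into one of them; the
complement is then the preimage, and solutions are pushed forward by `f` (`EffectiveMap.wle`).
Coordinate projections preserve connectedness under preimages, which gives monotonicity in the
dimension. A space-filling curve gives the reduction of every `connectedChoice n` to closed choice
on the interval.

The remaining reduction, from closed choice to dimension at least 3, replaces `A` by the set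
`thickening A`. It is path connected as soon as `A` is nonempty, since a coordinate can be moved
freely on one face while the other coordinate stays in `A`. A point of it yields an element of `A`:
its third coordinate, read to precision 1/4, shows that it is not 1 or that it is not 0, so the
first or the second coordinate lies in `A`.

Strictness has two sources. Dimension 0 has a constant realizer, so a reduction of dimension 1 to it
would solve the latter continuously; but a finite part of a name of the whole interval also begins a
name of a singleton far from the chosen answer. Dimension 1 and dimension 2 are separated by
non-uniform computability, which passes down along reductions. A nonempty subinterval contains a
rational point or is a singleton, and a co-c.e. singleton is computable by compactness. In dimension
2, `mixedCube singularSet` is connected and co-c.e.; a computable point of it would have a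
computable coordinate in `singularSet`, which omits all computable points because balls of total
length at most 1/2 cover them. -/

noncomputable section

namespace WeihrauchLattice

open RepresentedSpace DenseSequence

/-! ### Effective arithmetic on the enumeration of the nonnegative rationals -/

/-- Numerator of the `k`-th nonnegative rational. -/
def ratNum (k : ℕ) : ℕ := k.unpair.1

/-- Denominator of the `k`-th nonnegative rational. -/
def ratDen (k : ℕ) : ℕ := k.unpair.2 + 1

theorem ratDen_pos (k : ℕ) : 0 < ratDen k := Nat.succ_pos _

theorem nnRat_eq_div (k : ℕ) : nnRat k = (ratNum k : ℝ) / ratDen k := by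
  simp [nnRat, ratNum, ratDen]

/-- Index of the rational `a / d`, for `0 < d`. -/
def ratMk (a d : ℕ) : ℕ := Nat.pair a (d - 1)

theorem nnRat_ratMk (a : ℕ) {d : ℕ} (hd : 0 < d) : nnRat (ratMk a d) = (a : ℝ) / d := by
  rw [ratMk, nnRat_pair, Nat.cast_sub hd]; simp

/-- Addition on indices. -/
def ratAdd (j k : ℕ) : ℕ := ratMk (ratNum j * ratDen k + ratNum k * ratDen j) (ratDen j * ratDen k)

/-- Truncated subtraction on indices. -/
def ratSub (j k : ℕ) : ℕ := ratMk (ratNum j * ratDen k - ratNum k * ratDen j) (ratDen j * ratDen k)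

/-- Multiplication on indices. -/
def ratMul (j k : ℕ) : ℕ := ratMk (ratNum j * ratNum k) (ratDen j * ratDen k)

/-- The order on indices. -/
def ratLe (j k : ℕ) : Prop := ratNum j * ratDen k ≤ ratNum k * ratDen j

instance : DecidableRel ratLe := fun _ _ => Nat.decLe _ _

/-- Minimum on indices. -/
def ratMin (j k : ℕ) : ℕ := if ratLe j k then j else k

/-- Maximum on indices. -/
def ratMax (j k : ℕ) : ℕ := if ratLe j k then k else j

/-- The absolute value of the difference on indices. -/
def ratDist (j k : ℕ) : ℕ := ratAdd (ratSub j k) (ratSub k j)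

/-- Index of `(1 / 2) ^ i`. -/
def ratHalfPow (i : ℕ) : ℕ := ratMk 1 (2 ^ i)

theorem ratLe_iff (j k : ℕ) : ratLe j k ↔ nnRat j ≤ nnRat k := by
  have h1 : (0 : ℝ) < ratDen j := by exact_mod_cast ratDen_pos j
  have h2 : (0 : ℝ) < ratDen k := by exact_mod_cast ratDen_pos k
  rw [nnRat_eq_div, nnRat_eq_div, div_le_div_iff₀ h1 h2, ratLe]
  exact_mod_cast Iff.rfl

theorem nnRat_ratAdd (j k : ℕ) : nnRat (ratAdd j k) = nnRat j + nnRat k := by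
  have h1 : (0 : ℝ) < ratDen j := by exact_mod_cast ratDen_pos j
  have h2 : (0 : ℝ) < ratDen k := by exact_mod_cast ratDen_pos k
  rw [ratAdd, nnRat_ratMk _ (Nat.mul_pos (ratDen_pos j) (ratDen_pos k)), nnRat_eq_div, nnRat_eq_div]
  push_cast
  field_simp

theorem nnRat_ratSub (j k : ℕ) : nnRat (ratSub j k) = max (nnRat j - nnRat k) 0 := by
  have h1 : (0 : ℝ) < ratDen j := by exact_mod_cast ratDen_pos j
  have h2 : (0 : ℝ) < ratDen k := by exact_mod_cast ratDen_pos k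
  rw [ratSub, nnRat_ratMk _ (Nat.mul_pos (ratDen_pos j) (ratDen_pos k))]
  rcases le_total (nnRat j) (nnRat k) with h | h
  · rw [max_eq_right (by linarith), Nat.sub_eq_zero_of_le ((ratLe_iff j k).2 h)]
    simp
  · rw [max_eq_left (by linarith), Nat.cast_sub ((ratLe_iff k j).2 h), nnRat_eq_div, nnRat_eq_div]
    push_cast
    field_simp

theorem nnRat_ratMul (j k : ℕ) : nnRat (ratMul j k) = nnRat j * nnRat k := by
  have h1 : (0 : ℝ) < ratDen j := by exact_mod_cast ratDen_pos j
  have h2 : (0 : ℝ) < ratDen k := by exact_mod_cast ratDen_pos k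
  rw [ratMul, nnRat_ratMk _ (Nat.mul_pos (ratDen_pos j) (ratDen_pos k)), nnRat_eq_div, nnRat_eq_div]
  push_cast
  field_simp

theorem nnRat_ratMin (j k : ℕ) : nnRat (ratMin j k) = min (nnRat j) (nnRat k) := by
  unfold ratMin
  split_ifs with h
  · rw [min_eq_left ((ratLe_iff j k).1 h)]
  · rw [min_eq_right (le_of_not_ge (fun h' => h ((ratLe_iff j k).2 h')))]

theorem nnRat_ratMax (j k : ℕ) : nnRat (ratMax j k) = max (nnRat j) (nnRat k) := by
  unfold ratMax
  split_ifs with h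
  · rw [max_eq_right ((ratLe_iff j k).1 h)]
  · rw [max_eq_left (le_of_not_ge (fun h' => h ((ratLe_iff j k).2 h')))]

theorem nnRat_ratDist (j k : ℕ) : nnRat (ratDist j k) = |nnRat j - nnRat k| := by
  rw [ratDist, nnRat_ratAdd, nnRat_ratSub, nnRat_ratSub]
  rcases le_total (nnRat j) (nnRat k) with h | h
  · rw [max_eq_right (by linarith), max_eq_left (by linarith), abs_of_nonpos (by linarith)]
    ring
  · rw [max_eq_left (by linarith), max_eq_right (by linarith), abs_of_nonneg (by linarith)]
    ring

theorem nnRat_ratHalfPow (i : ℕ) : nnRat (ratHalfPow i) = (1 / 2 : ℝ) ^ i := by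
  rw [ratHalfPow, nnRat_ratMk _ (by positivity)]
  simp

@[simp] theorem nnRat_natCast (a : ℕ) : nnRat (Nat.pair a 0) = a := by
  rw [nnRat_pair]; simp

section Primrec

open Primrec

theorem primrec_nat_pow : Primrec₂ ((· ^ ·) : ℕ → ℕ → ℕ) := Primrec₂.unpaired'.1 Nat.Primrec.pow

theorem primrec_ratNum : Primrec ratNum := fst.comp .unpair

theorem primrec_ratDen : Primrec ratDen := succ.comp (snd.comp .unpair)

theorem primrec_ratMk : Primrec₂ ratMk :=
  Primrec₂.natPair.comp fst (nat_sub.comp snd (.const 1))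

theorem primrec_ratAdd : Primrec₂ ratAdd :=
  primrec_ratMk.comp
    (nat_add.comp (nat_mul.comp (primrec_ratNum.comp fst) (primrec_ratDen.comp snd))
      (nat_mul.comp (primrec_ratNum.comp snd) (primrec_ratDen.comp fst)))
    (nat_mul.comp (primrec_ratDen.comp fst) (primrec_ratDen.comp snd))

theorem primrec_ratSub : Primrec₂ ratSub :=
  primrec_ratMk.comp
    (nat_sub.comp (nat_mul.comp (primrec_ratNum.comp fst) (primrec_ratDen.comp snd))
      (nat_mul.comp (primrec_ratNum.comp snd) (primrec_ratDen.comp fst)))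
    (nat_mul.comp (primrec_ratDen.comp fst) (primrec_ratDen.comp snd))

theorem primrec_ratMul : Primrec₂ ratMul :=
  primrec_ratMk.comp (nat_mul.comp (primrec_ratNum.comp fst) (primrec_ratNum.comp snd))
    (nat_mul.comp (primrec_ratDen.comp fst) (primrec_ratDen.comp snd))

theorem primrecRel_ratLe : PrimrecRel ratLe :=
  nat_le.comp (nat_mul.comp (primrec_ratNum.comp fst) (primrec_ratDen.comp snd))
    (nat_mul.comp (primrec_ratNum.comp snd) (primrec_ratDen.comp fst))

theorem primrec_ratMin : Primrec₂ ratMin :=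
  ite (primrecRel_ratLe.comp fst snd) fst snd

theorem primrec_ratMax : Primrec₂ ratMax :=
  ite (primrecRel_ratLe.comp fst snd) snd fst

theorem primrec_ratDist : Primrec₂ ratDist :=
  primrec_ratAdd.comp (primrec_ratSub.comp fst snd) (primrec_ratSub.comp snd fst)

theorem primrec_ratHalfPow : Primrec ratHalfPow :=
  primrec_ratMk.comp (.const 1) (primrec_nat_pow.comp (.const 2) .id)

end Primrec

/-! ### Effective metrics -/

/-- The distances between the points of the dense sequence are uniformly computable rationals. -/
def EffectiveMetric (X : Type) [MetricSpace X] [DenseSequence X] : Prop :=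
  ∃ D : ℕ → ℕ → ℕ, Primrec₂ D ∧ ∀ j k, nnRat (D j k) = dist (pt j : X) (pt k)

theorem effectiveMetric_unitInterval : EffectiveMetric unitInterval := by
  have h1 : ∀ k, nnRat (ratMin (Nat.pair 1 0) k) = (ratPoint k : ℝ) := fun k => by
    rw [nnRat_ratMin]; simp [ratPoint]
  refine ⟨fun j k => ratDist (ratMin (Nat.pair 1 0) j) (ratMin (Nat.pair 1 0) k),
    primrec_ratDist.comp (primrec_ratMin.comp (.const _) .fst)
      (primrec_ratMin.comp (.const _) .snd), fun j k => ?_⟩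
  rw [nnRat_ratDist, h1, h1, Subtype.dist_eq, Real.dist_eq]
  rfl

/-- The index of the `i`-th coordinate of the `k`-th rational point of a cube. -/
def coordIndex (k i : ℕ) : ℕ := (Denumerable.ofNat (List ℕ) k).getD i 0

theorem primrec_coordIndex : Primrec₂ coordIndex :=
  (Primrec.list_getD 0).comp ((Primrec.ofNat (List ℕ)).comp .fst) .snd

theorem pt_cube_apply {n : ℕ} (k : ℕ) (i : Fin n) :
    (pt k : Cube n) i = pt (coordIndex k i) := rfl

/-- The maximum over the first `m` coordinates is built by recursion and described by its
nonnegative upper bounds, the form in which the product metric is known. This also covers the empty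
maximum, which is 0. -/
theorem effectiveMetric_cube (n : ℕ) : EffectiveMetric (Cube n) := by
  obtain ⟨D, hD, hd⟩ := effectiveMetric_unitInterval
  have key : ∀ m : ℕ, ∃ E : ℕ → ℕ → ℕ, Primrec₂ E ∧ ∀ j k, ∀ r : ℝ, 0 ≤ r →
      (nnRat (E j k) ≤ r ↔
        ∀ i < m, dist (pt (coordIndex j i) : unitInterval) (pt (coordIndex k i)) ≤ r) := by
    intro m
    induction m with
    | zero =>
      exact ⟨fun _ _ => Nat.pair 0 0, .const _, fun j k r hr => by simpa using hr⟩
    | succ m ih =>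
      obtain ⟨E, hE, he⟩ := ih
      refine ⟨fun j k => ratMax (E j k) (D (coordIndex j m) (coordIndex k m)),
        primrec_ratMax.comp hE (hD.comp (primrec_coordIndex.comp .fst (.const m))
          (primrec_coordIndex.comp .snd (.const m))), fun j k r hr => ?_⟩
      rw [nnRat_ratMax, max_le_iff, he j k r hr, hd, Nat.forall_lt_succ_right]
  obtain ⟨E, hE, he⟩ := key n
  refine ⟨E, hE, fun j k => ?_⟩
  have h : ∀ r : ℝ, 0 ≤ r → (nnRat (E j k) ≤ r ↔ dist (pt j : Cube n) (pt k) ≤ r) := by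
    intro r hr
    rw [he j k r hr, dist_pi_le_iff hr]
    exact ⟨fun H i => H i i.2, fun H i hi => H ⟨i, hi⟩⟩
  exact le_antisymm ((h _ dist_nonneg).2 le_rfl) ((h _ (nnRat_nonneg _)).1 le_rfl)

/-! ### Computable functions on Baire space -/

theorem length_initSeg (p : Baire) (n : ℕ) : (initSeg p n).length = n := by simp [initSeg]

theorem getD_initSeg (p : Baire) {i n : ℕ} (h : i < n) : (initSeg p n).getD i 0 = p i := by
  simp [initSeg, List.getD_eq_getElem?_getD, h]

theorem initSeg_succ (p : Baire) (n : ℕ) : initSeg p (n + 1) = initSeg p n ++ [p n] := by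
  simp [initSeg, List.range_succ]

theorem initSeg_prefix (p : Baire) {m n : ℕ} (h : m ≤ n) : initSeg p m <+: initSeg p n := by
  induction n, h using Nat.le_induction with
  | base => exact List.prefix_rfl
  | succ n _ ih => exact ih.trans (initSeg_succ p n ▸ List.prefix_append _ _)

theorem initSeg_congr {p q : Baire} {n : ℕ} (h : ∀ i < n, p i = q i) :
    initSeg p n = initSeg q n := by
  unfold initSeg
  exact List.map_congr_left fun i hi => h i (List.mem_range.1 hi)

theorem getElem?_initSeg (p : Baire) (i n : ℕ) :
    (initSeg p n)[i]? = if i < n then some (p i) else none := by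
  split_ifs with h <;> simp [initSeg, h]

theorem eq_of_initSeg_prefix {p q : Baire} {m n : ℕ} (h : initSeg p m <+: initSeg q n) {i : ℕ}
    (hi : i < m) : p i = q i := by
  obtain ⟨t, ht⟩ := h
  have h2 : (initSeg q n)[i]? = some (p i) := by
    rw [← ht, List.getElem?_append_left (by rwa [length_initSeg]), getElem?_initSeg, if_pos hi]
  rw [getElem?_initSeg] at h2
  split_ifs at h2
  exact (Option.some.inj h2).symm

theorem eq_initSeg_getD (v : List ℕ) : v = initSeg (fun i => v.getD i 0) v.length := by
  apply List.ext_getElem?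
  intro i
  rw [getElem?_initSeg]
  split_ifs with h
  · simp [List.getD_eq_getElem?_getD, h]
  · simpa using h

/-- A total function on Baire space, as a partial function. -/
def total (F : Baire → Baire) : Baire →. Baire := fun p => Part.some (F p)

theorem mem_total {F : Baire → Baire} {p q : Baire} : q ∈ total F p ↔ q = F p := Part.mem_some_iff

/-- A function each of whose output digits is a primitive recursive function of an initial segment
of the input of primitive recursively bounded length is computable. -/
theorem computableFun_total {F : Baire → Baire} {g : List ℕ → ℕ → ℕ} {s : ℕ → ℕ}
    (hg : Primrec₂ g) (hs : Primrec s)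
    (hF : ∀ p n m, s n ≤ m → F p n = g (initSeg p m) n) : ComputableFun (total F) := by
  let P : List ℕ → ℕ → Prop := fun u N => ∀ n < N, s n ≤ u.length
  have hP : PrimrecRel P := by
    have h : PrimrecRel fun n l : ℕ => s n ≤ l := Primrec.nat_le.comp (hs.comp .fst) .snd
    exact (PrimrecRel.forall_lt h).comp .snd (Primrec.list_length.comp .fst)
  classical
  -- `N u` is the number of output digits that `u` certainly determines; the cap `u.length` bounds
  -- the search.
  let N : List ℕ → ℕ := fun u => Nat.findGreatest (P u) u.length
  have hN : Primrec N := Primrec.nat_findGreatest Primrec.list_length hP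
  have hN1 : ∀ u, ∀ n < N u, s n ≤ u.length := fun u =>
    Nat.findGreatest_spec (P := P u) (Nat.zero_le _) (fun n hn => absurd hn (Nat.not_lt_zero n))
  have hN2 : ∀ u n, n ≤ u.length → P u n → n ≤ N u := fun u n h1 h2 => Nat.le_findGreatest h1 h2
  have hlen : ∀ u, N u ≤ u.length := fun u => Nat.findGreatest_le _
  have hform : ∀ p m, (List.range (N (initSeg p m))).map (g (initSeg p m)) =
      initSeg (F p) (N (initSeg p m)) := by
    intro p m
    refine List.map_congr_left fun n hn => (hF p n m ?_).symm
    simpa [length_initSeg] using hN1 _ n (List.mem_range.1 hn)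
  refine ⟨fun u => (List.range (N u)).map (g u),
    (Primrec.list_map (Primrec.list_range.comp hN) hg).to_comp, fun u v huv => ?_, fun p q hq => ?_⟩
  -- Both words are initial segments of `v` padded with zeros, so monotonicity reduces to that of
  -- `N`.
  · have hu : u = initSeg (fun i => v.getD i 0) u.length := by
      obtain ⟨t, rfl⟩ := huv
      conv_lhs => rw [eq_initSeg_getD u]
      exact initSeg_congr fun i hi => by simp [List.getD_eq_getElem?_getD, List.getElem?_append_left, hi]
    have hv := eq_initSeg_getD v
    have h1 := hform (fun i => v.getD i 0) u.length
    have h2 := hform (fun i => v.getD i 0) v.length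
    rw [← hu] at h1
    rw [← hv] at h2
    change List.map _ _ <+: List.map _ _
    rw [h1, h2]
    exact initSeg_prefix _ (hN2 _ _ ((hlen u).trans huv.length_le)
      fun n hn => (hN1 u n hn).trans huv.length_le)
  · rw [mem_total] at hq
    subst hq
    refine ⟨fun m => ⟨_, hform p m⟩, fun n => ?_⟩
    -- This length exceeds both the cap for `n` digits and the requirement `s i` of each digit below
    -- `n`.
    refine ⟨n + ∑ i ∈ Finset.range n, s i, ?_⟩
    change _ <+: (List.range (N _)).map _
    rw [hform]
    refine initSeg_prefix _ (hN2 _ _ (by simp [length_initSeg]) fun i hi => ?_)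
    rw [length_initSeg]
    exact (Finset.single_le_sum (fun _ _ => Nat.zero_le _) (Finset.mem_range.2 hi)).trans
      (Nat.le_add_left _ _)

/-- A function each of whose output digits depends primitive recursively on one input digit is
computable. -/
theorem computableFun_total_of_digit {F : Baire → Baire} {g : ℕ → ℕ → ℕ} {s : ℕ → ℕ}
    (hg : Primrec₂ g) (hs : Primrec s) (hF : ∀ p n, F p n = g (p (s n)) n) :
    ComputableFun (total F) :=
  computableFun_total (g := fun u n => g (u.getD (s n) 0) n) (s := fun n => s n + 1)
    (hg.comp ((Primrec.list_getD 0).comp .fst (hs.comp .snd)) .snd) (Primrec.succ.comp hs)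
    fun p n m hm => by rw [hF, getD_initSeg p hm]

theorem pair_odd (p q : Baire) (n : ℕ) : pair p q (2 * n + 1) = q n := by
  have h1 : (2 * n + 1) % 2 = 1 := by omega
  have h2 : (2 * n + 1) / 2 = n := by omega
  simp [pair, h1, h2]

theorem computable_initSeg {p : Baire} (hp : Computable p) : Computable (initSeg p) :=
  (Computable.nat_rec (f := fun n : ℕ => n) (g := fun _ => ([] : List ℕ))
    (h := fun _ a => a.2 ++ [p a.1]) .id (.const _)
    (Computable.list_concat.comp (Computable.snd.comp .snd)
      (hp.comp (Computable.fst.comp .snd)))).of_eq fun n => by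
    induction n with
    | zero => rfl
    | succ n ih => rw [initSeg_succ, ← ih]

theorem computable_pair {p q : Baire} (hp : Computable p) (hq : Computable q) :
    Computable (pair p q) :=
  (Computable.cond (c := fun n : ℕ => decide (n % 2 = 0))
    ((Primrec.eq.comp (Primrec.nat_mod.comp .id (.const 2)) (.const 0)).decide.to_comp)
    (hp.comp (Primrec.nat_div.comp .id (.const 2)).to_comp)
    (hq.comp (Primrec.nat_div.comp .id (.const 2)).to_comp)).of_eq fun n => by
      by_cases h : n % 2 = 0 <;> simp [pair, h]

/-- Computable functions map computable sequences to computable sequences. -/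
theorem ComputableFun.computable {F : Baire →. Baire} (hF : ComputableFun F) {p q : Baire}
    (hp : Computable p) (hq : q ∈ F p) : Computable q := by
  obtain ⟨h, hh, -, hpq⟩ := hF
  obtain ⟨h1, h2⟩ := hpq p q hq
  -- The `n`-th digit is found by searching for an input prefix whose approximation has a digit in
  -- position `n`; all approximations agree with `q`.
  have hc : Computable₂ fun n m => (h (initSeg p m))[n]? :=
    Computable.list_getElem?.comp (hh.comp ((computable_initSeg hp).comp .snd)) .fst
  refine (Partrec.rfindOpt hc).of_eq_tot fun n => ?_
  have hval : ∀ m a, a ∈ (h (initSeg p m))[n]? → a = q n := by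
    intro m a ha
    obtain ⟨k, hk⟩ := h1 m
    rw [hk, getElem?_initSeg] at ha
    split_ifs at ha
    · exact (Option.mem_some_iff.1 ha).symm
    · simp at ha
  have hdom : (Nat.rfindOpt fun m => (h (initSeg p m))[n]?).Dom := by
    rw [Nat.rfindOpt_dom]
    obtain ⟨m, hm⟩ := h2 (n + 1)
    obtain ⟨t, ht⟩ := hm
    refine ⟨m, q n, ?_⟩
    rw [← ht, List.getElem?_append_left (by simp [length_initSeg]), getElem?_initSeg]
    simp
  obtain ⟨m, hm⟩ := Nat.rfindOpt_spec (Part.get_mem hdom)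
  rw [← hval m _ hm]
  exact Part.get_mem hdom

/-- Unbounded search. -/
theorem exists_computable_of_forall_exists {R : ℕ → ℕ → Bool} (hR : Computable₂ R)
    (h : ∀ n, ∃ w, R n w = true) : ∃ g : ℕ → ℕ, Computable g ∧ ∀ n, R n (g n) = true := by
  choose w hw using h
  have hd : ∀ n, (Nat.rfind fun w => Part.some (R n w)).Dom := fun n => by
    obtain ⟨m, hm, -⟩ := Nat.rfind_min' (hw n)
    exact hm.1
  refine ⟨fun n => (Nat.rfind fun w => Part.some (R n w)).get (hd n), ?_, fun n => ?_⟩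
  · exact (Partrec.rfind (p := fun n w => Part.some (R n w)) hR.partrec₂).of_eq_tot
      fun n => Part.get_mem (hd n)
  · have := Nat.rfind_spec (Part.get_mem (hd n))
    exact (Part.mem_some_iff.1 this).symm

/-! ### Weihrauch reductions -/

section

variable {X Y Z W : Type} [RepresentedSpace X] [RepresentedSpace Y]
  [RepresentedSpace Z] [RepresentedSpace W]

/-- A Weihrauch reduction given by total computable functions on names. -/
theorem WLE.of_total {f : MultiFun X Y} {g : MultiFun Z W} {H K : Baire → Baire}
    (hH : ComputableFun (total H)) (hK : ComputableFun (total K))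
    (h : ∀ p, ∀ x ∈ rep (X := X) p, (f x).Nonempty → ∃ z ∈ rep (X := Z) (H p), (g z).Nonempty ∧
      ∀ q, ∀ y ∈ rep (X := W) q, y ∈ g z → ∃ w ∈ rep (X := Y) (K (pair p q)), w ∈ f x) :
    WLE f g := by
  refine ⟨total K, total H, hK, hH, fun G hG p x hx hne => ?_⟩
  obtain ⟨z, hz, hgz, hy⟩ := h p x hx hne
  obtain ⟨q, hq, y, hyq, hyz⟩ := hG (H p) z hz hgz
  obtain ⟨w, hw, hwf⟩ := hy q y hyq hyz
  exact ⟨K (pair p q), Part.mem_bind (mem_total.2 rfl) (Part.mem_bind hq (mem_total.2 rfl)),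
    w, hw, hwf⟩

/-- Non-uniform computability is preserved downwards by Weihrauch reducibility. -/
theorem WLE.nonuniformlyComputable {f : MultiFun X Y} {g : MultiFun Z W} (hfg : WLE f g)
    (hg : NonuniformlyComputable g) : NonuniformlyComputable f := by
  obtain ⟨K, H, hK, hH, h⟩ := hfg
  rintro x ⟨p, hp, hpx⟩ hne
  classical
  let Good : Baire → Baire → Prop := fun r q =>
    ∃ z ∈ rep (X := Z) r, ∃ y ∈ rep (X := W) q, y ∈ g z
  -- This realizer answers with a computable name whenever a correct one exists, so its answers to
  -- computable instances of `g` are computable. The fallback makes it a realizer on all other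
  -- names.
  let G : Baire →. Baire := fun r =>
    ⟨∃ q, Good r q, fun hr => if hc : ∃ q, Computable q ∧ Good r q then hc.choose else hr.choose⟩
  have hGood : ∀ r, ∀ q ∈ G r, Good r q := by
    rintro r q ⟨hr, rfl⟩
    change Good r (if hc : ∃ q, Computable q ∧ Good r q then hc.choose else Exists.choose hr)
    split_ifs with hc
    · exact hc.choose_spec.2
    · exact Exists.choose_spec hr
  have hG : Realizes G g := by
    rintro r z hz ⟨y, hy⟩
    obtain ⟨q, hq⟩ := RepresentedSpace.surjective y
    have hr : (G r).Dom := ⟨q, z, hz, y, hq, hy⟩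
    obtain ⟨z', hz', y', hy', hyz⟩ := hGood r _ (Part.get_mem hr)
    rw [Part.mem_unique hz' hz] at hyz
    exact ⟨_, Part.get_mem hr, y', hy', hyz⟩
  obtain ⟨t, ht, w, hw, hwf⟩ := h G hG p x hpx hne
  obtain ⟨r, hr, ht⟩ := Part.mem_bind_iff.1 ht
  obtain ⟨q, hq, ht⟩ := Part.mem_bind_iff.1 ht
  have hrc : Computable r := hH.computable hp hr
  have hqc : Computable q := by
    obtain ⟨z, hz, y, hy, hyz⟩ := hGood r q hq
    obtain ⟨y', hy', q', hq', hyq'⟩ := hg z ⟨r, hrc, hz⟩ ⟨y, hyz⟩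
    have hc : ∃ q, Computable q ∧ Good r q := ⟨q', hq', z, hz, y', hyq', hy'⟩
    obtain ⟨hd, rfl⟩ := hq
    change Computable (if hc : ∃ q, Computable q ∧ Good r q then hc.choose else Exists.choose hd)
    rw [dif_pos hc]
    exact hc.choose_spec.1
  exact ⟨w, hwf, t, hK.computable (computable_pair hp hqc) ht, hw⟩

end

/-! ### Names of points and of closed sets -/

section

variable {X Y : Type} [MetricSpace X] [DenseSequence X] [MetricSpace Y] [DenseSequence Y]

theorem mem_rep_iff {p : Baire} {x : X} : x ∈ rep (X := X) p ↔ IsCauchyName p x := mem_cauchyMap p x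

theorem mem_rep_closeds_iff {p : Baire} {A : TopologicalSpace.Closeds X} :
    A ∈ rep (X := TopologicalSpace.Closeds X) p ↔ A = negMap X p := Part.mem_some_iff

theorem mem_negMap_iff {p : Baire} {x : X} :
    x ∈ negMap X p ↔ ∀ i, nnRat (p i).unpair.2 ≤ dist x (pt (p i).unpair.1) := by
  change x ∈ (⋃ i, basicBall X (p i))ᶜ ↔ _
  simp [basicBall]

theorem notMem_negMap_iff {p : Baire} {x : X} :
    x ∉ negMap X p ↔ ∃ i, dist x (pt (p i).unpair.1) < nnRat (p i).unpair.2 := by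
  rw [mem_negMap_iff]; push Not; rfl

/-- The code 0 denotes an empty ball; it serves below as the dummy output that removes nothing. -/
theorem nnRat_unpair_zero : nnRat (Nat.unpair 0).2 = 0 := by simp [nnRat]

theorem IsCauchyName.dist_le {p : Baire} {x : X} (h : IsCauchyName p x) (i : ℕ) :
    dist x (pt (p i)) ≤ (1 / 2 : ℝ) ^ i := by
  rw [dist_comm]
  refine le_of_tendsto (Filter.Tendsto.dist tendsto_const_nhds h.2) ?_
  filter_upwards [Filter.eventually_gt_atTop i] with j hj using h.1 i j hj

/-- The exponent `i + 1` leaves room for two errors, at `i` and at `j`, within the allowed `2^{-i}`.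
-/
theorem isCauchyName_of_dist_le {p : Baire} {x : X}
    (h : ∀ i, dist x (pt (p i)) ≤ (1 / 2 : ℝ) ^ (i + 1)) : IsCauchyName p x := by
  refine ⟨fun i j hij => ?_, ?_⟩
  · have h1 := h i
    have h2 := h j
    have h3 : (1 / 2 : ℝ) ^ (j + 1) ≤ (1 / 2 : ℝ) ^ (i + 1) :=
      pow_le_pow_of_le_one (by norm_num) (by norm_num) (by omega)
    have h4 := dist_triangle_left (pt (p i) : X) (pt (p j)) x
    have h5 : (1 / 2 : ℝ) ^ (i + 1) = (1 / 2 : ℝ) ^ i / 2 := by ring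
    linarith
  · rw [tendsto_iff_dist_tendsto_zero]
    refine squeeze_zero (fun _ => dist_nonneg) (fun i => ?_)
      (tendsto_pow_atTop_nhds_zero_of_lt_one (r := (1 / 2 : ℝ)) (by norm_num) (by norm_num))
    have h1 := h i
    rw [pow_succ] at h1
    rw [dist_comm]
    have h2 : (0 : ℝ) < (1 / 2 : ℝ) ^ i := by positivity
    linarith

theorem isComputablePoint_pt (k : ℕ) : IsComputablePoint (pt k : X) :=
  ⟨fun _ => k, .const k, mem_rep_iff.2 (isCauchyName_of_dist_le fun i => by simp)⟩

theorem exists_half_pow_lt {ε : ℝ} (hε : 0 < ε) : ∃ i : ℕ, (1 / 2 : ℝ) ^ i < ε :=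
  exists_pow_lt_of_lt_one hε (by norm_num)

/-! ### Effectively uniformly continuous maps -/

/-- `f` is uniformly continuous with modulus `μ`, and `a k i` is the index of a point of the dense
sequence within `2^{-i}` of the image of the `k`-th point. -/
structure EffectiveMap (f : X → Y) (a : ℕ → ℕ → ℕ) (μ : ℕ → ℕ) : Prop where
  primrec_approx : Primrec₂ a
  primrec_modulus : Primrec μ
  dist_approx : ∀ k i, dist (f (pt k)) (pt (a k i)) ≤ (1 / 2 : ℝ) ^ i
  dist_le : ∀ i x y, dist x y ≤ (1 / 2 : ℝ) ^ μ i → dist (f x) (f y) ≤ (1 / 2 : ℝ) ^ i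

variable {f : X → Y} {a : ℕ → ℕ → ℕ} {μ : ℕ → ℕ}

theorem EffectiveMap.continuous (hf : EffectiveMap f a μ) : Continuous f := by
  refine Metric.continuous_iff.2 fun x ε hε => ?_
  obtain ⟨i, hi⟩ := exists_half_pow_lt hε
  exact ⟨(1 / 2) ^ μ i, by positivity, fun y hy => (hf.dist_le i y x hy.le).trans_lt hi⟩

/-- The action of an effective map on Cauchy names. -/
def mapName (a : ℕ → ℕ → ℕ) (μ : ℕ → ℕ) (p : Baire) : Baire := fun i =>
  a (p (μ (i + 2))) (i + 2)

theorem EffectiveMap.isCauchyName (hf : EffectiveMap f a μ) {p : Baire} {x : X}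
    (hp : IsCauchyName p x) : IsCauchyName (mapName a μ p) (f x) := by
  refine isCauchyName_of_dist_le fun i => ?_
  have h1 := hf.dist_le (i + 2) _ _ (hp.dist_le (μ (i + 2)))
  have h2 := hf.dist_approx (p (μ (i + 2))) (i + 2)
  have h3 := dist_triangle (f x) (f (pt (p (μ (i + 2))))) (pt (mapName a μ p i))
  have h4 : (1 / 2 : ℝ) ^ (i + 1) = 2 * (1 / 2 : ℝ) ^ (i + 2) := by rw [pow_succ _ (i + 1)]; ring
  unfold mapName at h3 ⊢
  linarith

open Primrec in
/-- Closed sets can be pulled back effectively along effective maps. -/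
theorem EffectiveMap.exists_preimage (hf : EffectiveMap f a μ) (hY : EffectiveMetric Y) :
    ∃ H : Baire → Baire, ComputableFun (total H) ∧
      ∀ p, (negMap X (H p) : Set X) = f ⁻¹' (negMap Y p) := by
  obtain ⟨D, hD, hd⟩ := hY
  -- Here `n` codes a position `j` in the list, a center `c` and a precision `i`, and `b` is the
  -- `j`-th listed ball. Of the margin `3 * 2^{-i}`, one part is spent on the modulus and one on
  -- approximating `f (pt c)`; the third makes the inequality strict.
  let g : ℕ → ℕ → ℕ := fun b n =>
    if ratLe (ratAdd (D (a n.unpair.2.unpair.1 n.unpair.2.unpair.2) b.unpair.1)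
      (ratMul (Nat.pair 3 0) (ratHalfPow n.unpair.2.unpair.2))) b.unpair.2
    then Nat.pair n.unpair.2.unpair.1 (ratHalfPow (μ n.unpair.2.unpair.2)) else 0
  have hu : Primrec fun n : ℕ => n.unpair.2 := snd.comp .unpair
  have hc : Primrec fun n : ℕ => n.unpair.2.unpair.1 := fst.comp (Primrec.unpair.comp hu)
  have hi : Primrec fun n : ℕ => n.unpair.2.unpair.2 := hu.comp hu
  have hg : Primrec₂ g := by
    refine Primrec.ite (primrecRel_ratLe.comp (primrec_ratAdd.comp (hD.comp (hf.primrec_approx.comp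
      (hc.comp snd) (hi.comp snd)) (fst.comp (Primrec.unpair.comp fst))) (primrec_ratMul.comp
      (.const _) (primrec_ratHalfPow.comp (hi.comp snd)))) (hu.comp fst))
      (Primrec₂.natPair.comp (hc.comp snd)
        (primrec_ratHalfPow.comp (hf.primrec_modulus.comp (hi.comp snd)))) (.const 0)
  refine ⟨fun p n => g (p n.unpair.1) n,
    computableFun_total_of_digit hg (fst.comp .unpair) fun _ _ => rfl, fun p => ?_⟩
  ext x
  rw [mem_preimage, SetLike.mem_coe, SetLike.mem_coe, ← not_iff_not, notMem_negMap_iff,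
    notMem_negMap_iff]
  constructor
  · rintro ⟨n, hn⟩
    refine ⟨n.unpair.1, ?_⟩
    simp only [g] at hn
    split_ifs at hn with h
    · rw [Nat.unpair_pair, nnRat_ratHalfPow] at hn
      rw [ratLe_iff, nnRat_ratAdd, nnRat_ratMul, nnRat_natCast, hd, nnRat_ratHalfPow] at h
      set c := n.unpair.2.unpair.1
      set i := n.unpair.2.unpair.2
      set b := p n.unpair.1
      have h1 := hf.dist_le i _ _ hn.le
      have h2 := hf.dist_approx c i
      have h3 := dist_triangle4 (f x) (f (pt c)) (pt (a c i)) (pt b.unpair.1)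
      have h4 : (0 : ℝ) < (1 / 2 : ℝ) ^ i := by positivity
      push_cast at h
      linarith
    · rw [nnRat_unpair_zero] at hn
      exact absurd hn (not_lt.2 dist_nonneg)
  · rintro ⟨j, hj⟩
    set b := p j with hb
    -- Five parts: three for the margin in the test of `g`, two for passing from `f x` to `pt (a c
    -- i)`.
    obtain ⟨i, hi⟩ := exists_half_pow_lt
      (show 0 < (nnRat b.unpair.2 - dist (f x) (pt b.unpair.1)) / 5 by linarith)
    obtain ⟨c, hc⟩ := (DenseSequence.dense (X := X)).exists_dist_lt x
      (show (0 : ℝ) < (1 / 2) ^ μ i by positivity)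
    refine ⟨Nat.pair j (Nat.pair c i), ?_⟩
    simp only [g, Nat.unpair_pair, ← hb]
    rw [if_pos]
    · rwa [Nat.unpair_pair, nnRat_ratHalfPow]
    · rw [ratLe_iff, nnRat_ratAdd, nnRat_ratMul, nnRat_natCast, hd, nnRat_ratHalfPow]
      have h1 := hf.dist_le i _ _ hc.le
      have h2 := hf.dist_approx c i
      have h5 := dist_triangle (pt (a c i)) (f (pt c)) (pt b.unpair.1)
      have h6 := dist_triangle (f (pt c)) (f x) (pt b.unpair.1)
      rw [dist_comm] at h2 h1
      push_cast
      linarith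

/-- Closed choice problems can be pulled back along effective maps. -/
theorem EffectiveMap.wle (hf : EffectiveMap f a μ) (hY : EffectiveMetric Y)
    {F : MultiFun (TopologicalSpace.Closeds Y) Y} {G : MultiFun (TopologicalSpace.Closeds X) X}
    (h : ∀ (A : TopologicalSpace.Closeds Y) (B : TopologicalSpace.Closeds X),
      (B : Set X) = f ⁻¹' A → (F A).Nonempty → (G B).Nonempty ∧ ∀ x ∈ G B, f x ∈ F A) :
    WLE F G := by
  obtain ⟨H, hH, hpre⟩ := hf.exists_preimage hY
  -- The digits at odd positions of `⟨p, q⟩` are those of `q`, so this is `mapName` applied to `q`.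
  have hK : ComputableFun (total fun r i => a (r (2 * μ (i + 2) + 1)) (i + 2)) :=
    computableFun_total_of_digit (g := fun k i => a k (i + 2))
      (hf.primrec_approx.comp .fst (Primrec.nat_add.comp .snd (.const 2)))
      (Primrec.succ.comp (Primrec.nat_mul.comp (.const 2)
        (hf.primrec_modulus.comp (Primrec.nat_add.comp .id (.const 2))))) fun _ _ => rfl
  refine WLE.of_total hH hK fun p A hA hne => ?_
  rw [mem_rep_closeds_iff] at hA
  subst hA
  obtain ⟨h1, h2⟩ := h _ (negMap X (H p)) (hpre p) hne
  refine ⟨_, mem_rep_closeds_iff.2 rfl, h1, fun q x hq hx => ⟨f x, ?_, h2 x hx⟩⟩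
  simp only [pair_odd]
  exact mem_rep_iff.2 (hf.isCauchyName (mem_rep_iff.1 hq))

end

/-! ### Projections of cubes -/

/-- The index of the rational point of the cube with the given coordinate indices. -/
def cubeIndex {n : ℕ} (v : Fin n → ℕ) : ℕ := Encodable.encode (List.ofFn v)

theorem coordIndex_cubeIndex {n : ℕ} (v : Fin n → ℕ) (i : Fin n) :
    coordIndex (cubeIndex v) i = v i := by
  simp [coordIndex, cubeIndex]

theorem primrec_cubeIndex {α : Type*} [Primcodable α] {n : ℕ} {v : α → Fin n → ℕ}
    (hv : ∀ i, Primrec fun a => v a i) : Primrec fun a => cubeIndex (v a) :=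
  Primrec.encode.comp (Primrec.list_ofFn (f := fun i a => v a i) hv)

/-- Selecting coordinates does not increase distances and sends rational points to rational points,
so the modulus is the identity and the approximation is exact. -/
theorem effectiveMap_comp {m n : ℕ} (e : Fin m → Fin n) :
    EffectiveMap (fun (x : Cube n) => (x ∘ e : Cube m))
      (fun k _ => cubeIndex fun j => coordIndex k (e j)) id where
  primrec_approx := primrec_cubeIndex fun j => primrec_coordIndex.comp .fst (.const _)
  primrec_modulus := .id
  dist_approx k i := by
    refine (dist_pi_le_iff (by positivity)).2 fun j => ?_
    rw [pt_cube_apply, coordIndex_cubeIndex, Function.comp_apply, pt_cube_apply, dist_self]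
    positivity
  dist_le i x y h := by
    refine (dist_pi_le_iff (by positivity)).2 fun j => ?_
    exact (dist_le_pi_dist x y (e j)).trans h

/-- The preimage is the continuous image of the connected set `A ×ˢ univ` under the map that
overwrites the coordinates in the range of `e`; injectivity makes the overwriting consistent. -/
theorem isConnected_preimage_comp {m n : ℕ} {e : Fin m → Fin n} (he : Function.Injective e)
    {A : Set (Cube m)} (hA : IsConnected A) :
    IsConnected ((fun (x : Cube n) => (x ∘ e : Cube m)) ⁻¹' A) := by
  let σ : Cube m × Cube n → Cube n := fun z => Function.extend e z.1 z.2
  have hσ : Continuous σ := by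
    refine continuous_pi fun j => ?_
    by_cases hj : ∃ i, e i = j
    · obtain ⟨i, rfl⟩ := hj
      simp only [σ, he.extend_apply]
      fun_prop
    · simp only [σ, Function.extend_apply' _ _ _ hj]
      fun_prop
  have himage : (fun (x : Cube n) => (x ∘ e : Cube m)) ⁻¹' A = σ '' (A ×ˢ univ) := by
    ext x
    constructor
    · intro hx
      refine ⟨(x ∘ e, x), ⟨hx, mem_univ _⟩, ?_⟩
      funext j
      by_cases hj : ∃ i, e i = j
      · obtain ⟨i, rfl⟩ := hj
        simp [σ, he.extend_apply]
      · simp [σ, Function.extend_apply' _ _ _ hj]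
    · rintro ⟨⟨b, y⟩, ⟨hb, -⟩, rfl⟩
      have : σ (b, y) ∘ e = b := funext fun i => he.extend_apply _ _ _
      rw [mem_preimage, this]
      exact hb
  rw [himage]
  exact (hA.prod isConnected_univ).image _ hσ.continuousOn

theorem connectedChoice_nonempty_iff {n : ℕ} {A : TopologicalSpace.Closeds (Cube n)} :
    (connectedChoice n A).Nonempty ↔ IsConnected (A : Set (Cube n)) :=
  ⟨fun ⟨_, h, _⟩ => h, fun h => h.nonempty.imp fun _ hx => ⟨h, hx⟩⟩

theorem connectedChoice_wle_of_le {m n : ℕ} (h : m ≤ n) :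
    WLE (connectedChoice m) (connectedChoice n) := by
  refine (effectiveMap_comp (Fin.castLE h)).wle (effectiveMetric_cube m) fun A B hB hne => ?_
  rw [connectedChoice_nonempty_iff] at hne
  have hBc : IsConnected (B : Set (Cube n)) := by
    rw [hB]
    exact isConnected_preimage_comp (Fin.castLE_injective h) hne
  refine ⟨connectedChoice_nonempty_iff.2 hBc, fun x hx => ⟨hne, ?_⟩⟩
  have hxB : x ∈ (B : Set (Cube n)) := hx.2
  rw [hB] at hxB
  exact hxB

/-! ### An effective surjection of the unit interval onto a cube -/

/-- A piecewise linear function of period `1`, with value `0` on `[0, 1/8]` and `1` on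
`[1/4, 3/4]`. -/
def trapezoid (x : ℝ) : ℝ := min 1 (max (8 * |x - round x| - 1) 0)

theorem trapezoid_nonneg (x : ℝ) : 0 ≤ trapezoid x := le_min zero_le_one (le_max_right _ _)

theorem trapezoid_le_one (x : ℝ) : trapezoid x ≤ 1 := min_le_left _ _

theorem abs_trapezoid_sub_le (x y : ℝ) : |trapezoid x - trapezoid y| ≤ 8 * |x - y| := by
  have key : ∀ x y : ℝ, |x - round x| ≤ |x - y| + |y - round y| := fun x y =>
    (round_le x (round y)).trans (abs_sub_le x y _)
  have h1 := key x y
  have h2 := key y x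
  rw [abs_sub_comm y x] at h2
  have h3 := abs_min_sub_min_le_max 1 (max (8 * |x - round x| - 1) 0) 1
    (max (8 * |y - round y| - 1) 0)
  have h4 := abs_max_sub_max_le_max (8 * |x - round x| - 1) 0 (8 * |y - round y| - 1) 0
  refine h3.trans ((max_le (by simp) le_rfl).trans (h4.trans (max_le ?_ (by simp))))
  rw [abs_le]
  constructor <;> linarith

theorem trapezoid_natCast_add (m : ℕ) (x : ℝ) : trapezoid (m + x) = trapezoid x := by
  unfold trapezoid
  rw [round_natCast_add]
  push_cast
  rw [add_sub_add_left_eq_sub]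

theorem trapezoid_eq_zero {x : ℝ} (h0 : 0 ≤ x) (h1 : x ≤ 1 / 8) : trapezoid x = 0 := by
  have h := round_le x 0
  rw [Int.cast_zero, sub_zero, abs_of_nonneg h0] at h
  unfold trapezoid
  rw [max_eq_right (by linarith), min_eq_right zero_le_one]

theorem trapezoid_eq_one {x : ℝ} (h0 : 1 / 4 ≤ x) (h1 : x ≤ 3 / 4) : trapezoid x = 1 := by
  have h : 1 / 4 ≤ |x - round x| := by
    rcases le_or_gt (round x) 0 with hr | hr
    · have : (round x : ℝ) ≤ 0 := by exact_mod_cast hr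
      exact le_trans (by linarith) (le_abs_self _)
    · have : (1 : ℝ) ≤ round x := by exact_mod_cast hr
      exact le_trans (by linarith) (neg_le_abs _)
  unfold trapezoid
  rw [min_eq_left]
  exact le_max_of_le_left (by linarith)

/-- The partial sums of the coordinates of the space-filling curve. -/
def curveSum (n i m : ℕ) (t : ℝ) : ℝ :=
  ∑ k ∈ Finset.range m, (1 / 2 : ℝ) ^ (k + 1) * trapezoid (8 ^ (n * k + i) * t)

/-- The `i`-th coordinate of a space-filling curve in dimension `n`. -/
def curveCoord (n i : ℕ) (t : ℝ) : ℝ :=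
  ∑' k, (1 / 2 : ℝ) ^ (k + 1) * trapezoid (8 ^ (n * k + i) * t)

theorem hasSum_half_pow_succ : HasSum (fun k : ℕ => (1 / 2 : ℝ) ^ (k + 1)) 1 := by
  have h := hasSum_geometric_two.mul_right (1 / 2 : ℝ)
  simpa [pow_succ] using h

theorem summable_curve (n i : ℕ) (t : ℝ) :
    Summable fun k => (1 / 2 : ℝ) ^ (k + 1) * trapezoid (8 ^ (n * k + i) * t) :=
  Summable.of_nonneg_of_le (fun k => mul_nonneg (by positivity) (trapezoid_nonneg _))
    (fun k => mul_le_of_le_one_right (by positivity) (trapezoid_le_one _))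
    hasSum_half_pow_succ.summable

theorem curveSum_nonneg (n i m : ℕ) (t : ℝ) : 0 ≤ curveSum n i m t :=
  Finset.sum_nonneg fun _ _ => mul_nonneg (by positivity) (trapezoid_nonneg _)

theorem curveSum_le (n i m : ℕ) (t : ℝ) : curveSum n i m t ≤ curveCoord n i t :=
  (summable_curve n i t).sum_le_tsum _ fun _ _ => mul_nonneg (by positivity) (trapezoid_nonneg _)

theorem curveCoord_le (n i m : ℕ) (t : ℝ) :
    curveCoord n i t ≤ curveSum n i m t + (1 / 2 : ℝ) ^ m := by
  have hs := summable_curve n i t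
  unfold curveCoord curveSum
  rw [← hs.sum_add_tsum_nat_add m]
  gcongr
  have h := hasSum_half_pow_succ.mul_left ((1 / 2 : ℝ) ^ m)
  rw [mul_one] at h
  refine (Summable.tsum_le_tsum (fun k => ?_) ((summable_nat_add_iff m).2 hs) h.summable).trans
    h.tsum_eq.le
  rw [← pow_add, show m + (k + 1) = k + m + 1 by ring]
  exact mul_le_of_le_one_right (by positivity) (trapezoid_le_one _)

theorem curveCoord_mem (n i : ℕ) (t : ℝ) : curveCoord n i t ∈ unitInterval :=
  ⟨(curveSum_nonneg n i 0 t).trans (curveSum_le n i 0 t), by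
    simpa [curveSum] using curveCoord_le n i 0 t⟩

theorem sum_half_pow_succ_le (m : ℕ) : ∑ k ∈ Finset.range m, (1 / 2 : ℝ) ^ (k + 1) ≤ 1 :=
  sum_le_hasSum _ (fun _ _ => by positivity) hasSum_half_pow_succ

/-- Before weighting, each summand has Lipschitz constant at most `8 * 8 ^ (n * m)`, and the weights
sum to at most 1. -/
theorem abs_curveSum_sub_le {n i : ℕ} (hi : i < n) (m : ℕ) (s t : ℝ) :
    |curveSum n i m s - curveSum n i m t| ≤ 8 * 8 ^ (n * m) * |s - t| := by
  unfold curveSum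
  rw [← Finset.sum_sub_distrib]
  refine (Finset.abs_sum_le_sum_abs _ _).trans ?_
  have h : ∀ k ∈ Finset.range m, |(1 / 2 : ℝ) ^ (k + 1) * trapezoid (8 ^ (n * k + i) * s) -
      (1 / 2 : ℝ) ^ (k + 1) * trapezoid (8 ^ (n * k + i) * t)| ≤
      (1 / 2 : ℝ) ^ (k + 1) * (8 * 8 ^ (n * m) * |s - t|) := by
    intro k hk
    rw [← mul_sub, abs_mul, abs_of_nonneg (show (0 : ℝ) ≤ (1 / 2) ^ (k + 1) by positivity)]
    gcongr
    refine (abs_trapezoid_sub_le _ _).trans ?_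
    rw [← mul_sub, abs_mul, abs_of_nonneg (show (0 : ℝ) ≤ 8 ^ (n * k + i) by positivity), mul_assoc]
    gcongr
    · norm_num
    · have hk1 : k + 1 ≤ m := Finset.mem_range.1 hk
      calc n * k + i ≤ n * k + n := by omega
        _ = n * (k + 1) := by ring
        _ ≤ n * m := Nat.mul_le_mul_left n hk1
  refine (Finset.sum_le_sum h).trans ?_
  rw [← Finset.sum_mul]
  exact mul_le_of_le_one_left (by positivity) (sum_half_pow_succ_le m)

/-- A space-filling curve. -/
def curve (n : ℕ) (t : unitInterval) : Cube n := fun i => ⟨curveCoord n i t, curveCoord_mem n i t⟩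

/-- Index of the distance to the nearest integer. -/
def ratNearest (k : ℕ) : ℕ :=
  ratMk (min (ratNum k % ratDen k) (ratDen k - ratNum k % ratDen k)) (ratDen k)

theorem nnRat_ratNearest (k : ℕ) : nnRat (ratNearest k) = |nnRat k - round (nnRat k)| := by
  have h : (0 : ℝ) < ratDen k := by exact_mod_cast ratDen_pos k
  have hr := (Nat.mod_lt (ratNum k) (ratDen_pos k)).le
  rw [abs_sub_round_eq_min, nnRat_eq_div k, Int.fract_div_natCast_eq_div_natCast_mod, ratNearest,
    nnRat_ratMk _ (ratDen_pos k), Nat.cast_min, Nat.cast_sub hr, ← min_div_div_right h.le, sub_div,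
    div_self h.ne']

/-- The trapezoid function on indices. -/
def ratTrapezoid (k : ℕ) : ℕ :=
  ratMin (Nat.pair 1 0) (ratSub (ratMul (Nat.pair 8 0) (ratNearest k)) (Nat.pair 1 0))

theorem nnRat_ratTrapezoid (k : ℕ) : nnRat (ratTrapezoid k) = trapezoid (nnRat k) := by
  rw [ratTrapezoid, nnRat_ratMin, nnRat_ratSub, nnRat_ratMul, nnRat_ratNearest, nnRat_natCast,
    nnRat_natCast, trapezoid]
  simp

/-- The partial sums of the coordinates of the curve on indices. -/
def ratCurveSum (n i k : ℕ) : ℕ → ℕ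
  | 0 => Nat.pair 0 0
  | m + 1 => ratAdd (ratCurveSum n i k m) (ratMul (ratHalfPow (m + 1))
      (ratTrapezoid (ratMul (Nat.pair (8 ^ (n * m + i)) 0) k)))

theorem nnRat_ratCurveSum (n i k m : ℕ) : nnRat (ratCurveSum n i k m) = curveSum n i m (nnRat k) := by
  induction m with
  | zero => simp [ratCurveSum, curveSum]
  | succ m ih =>
    rw [ratCurveSum, nnRat_ratAdd, ih, nnRat_ratMul, nnRat_ratHalfPow, nnRat_ratTrapezoid,
      nnRat_ratMul, nnRat_natCast]
    simp [curveSum, Finset.sum_range_succ]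

section Primrec

open Primrec

theorem primrec_ratNearest : Primrec ratNearest := by
  have h : Primrec fun k => ratNum k % ratDen k := nat_mod.comp primrec_ratNum primrec_ratDen
  exact primrec_ratMk.comp (nat_min.comp h (nat_sub.comp primrec_ratDen h)) primrec_ratDen

theorem primrec_ratTrapezoid : Primrec ratTrapezoid :=
  primrec_ratMin.comp (.const _)
    (primrec_ratSub.comp (primrec_ratMul.comp (.const _) primrec_ratNearest) (.const _))

theorem primrec_ratCurveSum (n i : ℕ) : Primrec₂ (ratCurveSum n i) := by
  have hm : Primrec fun a : ℕ × ℕ × ℕ => a.2.1 := fst.comp snd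
  refine (Primrec.nat_rec (f := fun _ : ℕ => Nat.pair 0 0) (g := fun (k : ℕ) (a : ℕ × ℕ) =>
      ratAdd a.2 (ratMul (ratHalfPow (a.1 + 1))
        (ratTrapezoid (ratMul (Nat.pair (8 ^ (n * a.1 + i)) 0) k)))) (.const _)
    (primrec_ratAdd.comp (snd.comp snd) (primrec_ratMul.comp
      (primrec_ratHalfPow.comp (succ.comp hm))
      (primrec_ratTrapezoid.comp (primrec_ratMul.comp (Primrec₂.natPair.comp
        (primrec_nat_pow.comp (.const 8) (nat_add.comp (nat_mul.comp (.const n) hm) (.const i)))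
        (.const 0)) fst))))).of_eq fun k m => ?_
  induction m with
  | zero => rfl
  | succ m ih => exact congrArg (fun s => ratAdd s _) ih

end Primrec

theorem effectiveMap_curve (n : ℕ) :
    EffectiveMap (curve n)
      (fun k e => cubeIndex fun j : Fin n => ratCurveSum n j (ratMin (Nat.pair 1 0) k) e)
      -- The three summands cancel `8 ^ (n * (e + 1))`, cancel the factor 8, and leave `2^{-(e+1)}`
      -- for the partial sums of length `e + 1`; their tails account for the other half of `2^{-e}`.
      (fun e => 3 * n * (e + 1) + 3 + (e + 1)) where
  primrec_approx := primrec_cubeIndex fun j => (primrec_ratCurveSum n j).comp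
    (primrec_ratMin.comp (.const _) .fst) .snd
  primrec_modulus := Primrec.nat_add.comp (Primrec.nat_add.comp (Primrec.nat_mul.comp (.const _)
    Primrec.succ) (.const 3)) Primrec.succ
  dist_approx k e := by
    refine (dist_pi_le_iff (by positivity)).2 fun j => ?_
    rw [pt_cube_apply, coordIndex_cubeIndex, Subtype.dist_eq]
    have hk : nnRat (ratMin (Nat.pair 1 0) k) = (ratPoint k : ℝ) := by
      rw [nnRat_ratMin]; simp [ratPoint]
    change dist (curveCoord n j (ratPoint k : ℝ)) (min 1 (nnRat _)) ≤ _
    rw [nnRat_ratCurveSum, hk]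
    have h1 := curveSum_le n j e (ratPoint k : ℝ)
    have h2 := curveCoord_le n j e (ratPoint k : ℝ)
    have h3 := (curveCoord_mem n j (ratPoint k : ℝ)).2
    rw [min_eq_right (h1.trans h3), Real.dist_eq, abs_of_nonneg (by linarith)]
    linarith
  dist_le e x y h := by
    refine (dist_pi_le_iff (by positivity)).2 fun j => ?_
    rw [Subtype.dist_eq]
    change dist (curveCoord n j x) (curveCoord n j y) ≤ _
    rw [Subtype.dist_eq, Real.dist_eq] at h
    have h1 := curveSum_le n j (e + 1) x
    have h2 := curveCoord_le n j (e + 1) x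
    have h3 := curveSum_le n j (e + 1) y
    have h4 := curveCoord_le n j (e + 1) y
    have h5 := abs_curveSum_sub_le j.2 (e + 1) x y
    have h6 : 8 * 8 ^ (n * (e + 1)) * |(x : ℝ) - y| ≤ (1 / 2 : ℝ) ^ (e + 1) := by
      refine (mul_le_mul_of_nonneg_left h (by positivity)).trans_eq ?_
      have h9 : (8 : ℝ) ^ (n * (e + 1)) * (1 / 2) ^ (3 * n * (e + 1)) = 1 := by
        rw [mul_assoc, pow_mul (1 / 2 : ℝ), ← mul_pow]
        norm_num
      rw [pow_add, pow_add, ← mul_assoc, ← mul_assoc, mul_assoc (8 : ℝ), h9]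
      norm_num
    have h7 := abs_le.1 (h5.trans h6)
    have h8 : (1 / 2 : ℝ) ^ e = 2 * (1 / 2) ^ (e + 1) := by rw [pow_succ]; ring
    rw [Real.dist_eq, h8, abs_le]
    constructor <;> linarith [h7.1, h7.2]

/-- After scaling by `8 ^ j` the first `j` octal digits form an integer, which the periodic
trapezoid ignores. -/
theorem exists_natCast_eq_pow_mul_sum (c : ℕ → Fin 8) (j : ℕ) :
    ∃ z : ℕ, (8 : ℝ) ^ j * ∑ l ∈ Finset.range j, Real.ofDigitsTerm c l = z := by
  induction j with
  | zero => exact ⟨0, by simp⟩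
  | succ j ih =>
    obtain ⟨z, hz⟩ := ih
    refine ⟨8 * z + c j, ?_⟩
    rw [Finset.sum_range_succ, Real.ofDigitsTerm, mul_add, pow_succ']
    push_cast
    rw [← hz, pow_succ']
    field_simp

/-- With octal digits 0 and 4 only, the shifted number lies modulo 1 in `[0, 1/8]` or in `[1/2,
5/8]` according to the digit `b j`, and the trapezoid is constant on each of these intervals. -/
theorem trapezoid_pow_mul_ofDigits (b : ℕ → Fin 2) (j : ℕ) :
    trapezoid (8 ^ j * Real.ofDigits (fun l => (⟨4 * b l, by omega⟩ : Fin 8))) = (b j : ℕ) := by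
  set c : ℕ → Fin 8 := fun l => ⟨4 * b l, by omega⟩ with hc
  obtain ⟨z, hz⟩ := exists_natCast_eq_pow_mul_sum c j
  have h1 := Real.ofDigits_eq_sum_add_ofDigits c j
  have h2 := Real.ofDigits_eq_sum_add_ofDigits (fun i => c (i + j)) 1
  have h3 := Real.ofDigits_nonneg (fun i => c (i + 1 + j))
  have h4 := Real.ofDigits_le_one (fun i => c (i + 1 + j))
  rw [h1, mul_add, Nat.cast_ofNat, hz, ← mul_assoc, mul_inv_cancel₀ (by positivity), one_mul,
    trapezoid_natCast_add, h2]
  simp only [Finset.range_one, Finset.sum_singleton, Real.ofDigitsTerm, zero_add, pow_one, hc]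
  simp only [hc] at h3 h4
  push_cast
  have hb : (b j : ℕ) = 0 ∨ (b j : ℕ) = 1 := by omega
  rcases hb with hb | hb
  · rw [hb]
    push_cast
    exact trapezoid_eq_zero (by linarith) (by linarith)
  · rw [hb]
    push_cast
    exact trapezoid_eq_one (by linarith) (by linarith)

theorem curve_surjective (n : ℕ) : Function.Surjective (curve n) := by
  intro y
  have h : ∀ i : Fin n, ∃ b : ℕ → Fin 2, Real.ofDigits b = y i := fun i => by
    obtain ⟨b, -, hb⟩ := Real.ofDigits_SurjOn one_lt_two (y i).2
    exact ⟨b, hb⟩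
  choose b hb using h
  -- The binary expansions of the coordinates are interleaved: digit `n * k + i` is the `k`-th digit
  -- of coordinate `i`. For `n = 0` the value is irrelevant.
  let b' : ℕ → Fin 2 := fun j => if hn : 0 < n then b ⟨j % n, Nat.mod_lt j hn⟩ (j / n) else 0
  refine ⟨⟨Real.ofDigits (fun l => (⟨4 * b' l, by omega⟩ : Fin 8)), Real.ofDigits_nonneg _,
    Real.ofDigits_le_one _⟩, ?_⟩
  funext i
  apply Subtype.ext
  change curveCoord n i _ = _
  rw [← hb i]
  refine tsum_congr fun k => ?_
  have hn : 0 < n := i.pos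
  have hbk : b' (n * k + i) = b i k := by
    have h1 : (n * k + i) % n = i := by rw [Nat.mul_add_mod, Nat.mod_eq_of_lt i.2]
    have h2 : (n * k + i) / n = k := by
      rw [Nat.mul_add_div hn, Nat.div_eq_of_lt i.2, add_zero]
    simp only [b', dif_pos hn, h1, h2]
  rw [trapezoid_pow_mul_ofDigits, hbk, Real.ofDigitsTerm]
  simp [mul_comm]

theorem connectedChoice_wle_closedChoice (n : ℕ) :
    WLE (connectedChoice n) (closedChoice unitInterval) := by
  refine (effectiveMap_curve n).wle (effectiveMetric_cube n) fun A B hB hne => ?_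
  rw [connectedChoice_nonempty_iff] at hne
  refine ⟨?_, fun x hx => ⟨hne, ?_⟩⟩
  · change (B : Set unitInterval).Nonempty
    rw [hB]
    exact hne.nonempty.preimage (curve_surjective n)
  · have hxB : x ∈ (B : Set unitInterval) := hx
    rw [hB] at hxB
    exact hxB

/-! ### Connectedness along coordinate segments -/

theorem joinedIn_of_continuous {n : ℕ} {S : Set (Cube n)} {γ : unitInterval → Cube n}
    (hγ : Continuous γ) (hS : ∀ s, γ s ∈ S) (s t : unitInterval) : JoinedIn S (γ s) (γ t) := by
  have : PathConnectedSpace unitInterval :=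
    isPathConnected_iff_pathConnectedSpace.1 ((convex_Icc (0 : ℝ) 1).isPathConnected ⟨0, by simp⟩)
  exact ⟨(PathConnectedSpace.somePath s t).map hγ, fun u => hS _⟩

/-- The points of the cube whose first coordinate lies in `A` unless the third one is `1`, and whose
second coordinate lies in `A` unless the third one is `0`. -/
def thickening (A : Set unitInterval) : Set (Cube 3) :=
  {x | (x 0 ∈ A ∨ x 2 = 1) ∧ (x 1 ∈ A ∨ x 2 = 0)}

/-- Every point is joined to `(a, a, 0)`. On the face `z = 1` the first coordinate moves freely, on
`z = 0` the second, and above a point of `A × A` the third; a point strictly between the faces is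
first lowered to `z = 0`. -/
theorem isConnected_thickening {A : Set unitInterval} (hA : A.Nonempty) :
    IsConnected (thickening A) := by
  obtain ⟨a, ha⟩ := hA
  set S := thickening A with hS
  have mem : ∀ x y z : unitInterval, ![x, y, z] ∈ S ↔ (x ∈ A ∨ z = 1) ∧ (y ∈ A ∨ z = 0) :=
    fun x y z => Iff.rfl
  have move0 : ∀ y z x x' : unitInterval, (∀ s, ![s, y, z] ∈ S) →
      JoinedIn S ![x, y, z] ![x', y, z] := fun y z x x' h =>
    joinedIn_of_continuous (γ := fun s => ![s, y, z])
      (continuous_pi fun i => by fin_cases i <;> simp <;> fun_prop) h x x'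
  have move1 : ∀ x z y y' : unitInterval, (∀ s, ![x, s, z] ∈ S) →
      JoinedIn S ![x, y, z] ![x, y', z] := fun x z y y' h =>
    joinedIn_of_continuous (γ := fun s => ![x, s, z])
      (continuous_pi fun i => by fin_cases i <;> simp <;> fun_prop) h y y'
  have move2 : ∀ x y z z' : unitInterval, (∀ s, ![x, y, s] ∈ S) →
      JoinedIn S ![x, y, z] ![x, y, z'] := fun x y z z' h =>
    joinedIn_of_continuous (γ := fun s => ![x, y, s])
      (continuous_pi fun i => by fin_cases i <;> simp <;> fun_prop) h z z'
  have h1 : ∀ x y, y ∈ A → JoinedIn S ![x, y, 1] ![a, a, 0] := fun x y hy =>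
    ((move0 y 1 x a fun s => by simp [mem, hy]).trans
      (move2 a y 1 0 fun s => by simp [mem, ha, hy])).trans
      (move1 a 0 y a fun s => by simp [mem, ha])
  have h0 : ∀ x y, x ∈ A → JoinedIn S ![x, y, 0] ![a, a, 0] := fun x y hx =>
    ((move1 x 0 y a fun s => by simp [mem, hx]).trans
      (move2 x a 0 1 fun s => by simp [mem, ha, hx])).trans (h1 x a ha)
  refine IsPathConnected.isConnected ⟨![a, a, 0], by simp [mem, ha], fun {w} hw => JoinedIn.symm ?_⟩
  have hw' : w = ![w 0, w 1, w 2] := by funext i; fin_cases i <;> rfl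
  rw [hw'] at hw ⊢
  rw [mem] at hw
  by_cases hz0 : w 2 = 0
  · rw [hz0] at hw ⊢
    exact h0 _ _ (by simpa using hw)
  by_cases hz1 : w 2 = 1
  · rw [hz1] at hw ⊢
    exact h1 _ _ (by simpa using hw)
  simp only [hz0, hz1, or_false] at hw
  exact (move2 _ _ _ 0 fun s => by simp [mem, hw.1, hw.2]).trans (h0 _ _ hw.1)

/-- From a point with one coordinate in `A`, the other can slide to `a`; then the first can slide to
`a` as well. -/
theorem isConnected_mixedCube {A : TopologicalSpace.Closeds unitInterval}
    (hA : (A : Set unitInterval).Nonempty) : IsConnected (mixedCube A : Set (Cube 2)) := by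
  obtain ⟨a, ha⟩ := hA
  have ha : a ∈ A := ha
  set S := (mixedCube A : Set (Cube 2)) with hS
  have mem : ∀ x y : unitInterval, ![x, y] ∈ S ↔ x ∈ A ∨ y ∈ A := fun x y => Iff.rfl
  have move0 : ∀ y x x' : unitInterval, y ∈ A → JoinedIn S ![x, y] ![x', y] := fun y x x' h =>
    joinedIn_of_continuous (γ := fun s => ![s, y])
      (continuous_pi fun i => by fin_cases i <;> simp <;> fun_prop) (fun s => by simp [mem, h]) x x'
  have move1 : ∀ x y y' : unitInterval, x ∈ A → JoinedIn S ![x, y] ![x, y'] := fun x y y' h =>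
    joinedIn_of_continuous (γ := fun s => ![x, s])
      (continuous_pi fun i => by fin_cases i <;> simp <;> fun_prop) (fun s => by simp [mem, h]) y y'
  refine IsPathConnected.isConnected ⟨![a, a], by simp [mem, ha], fun {w} hw => JoinedIn.symm ?_⟩
  have hw' : w = ![w 0, w 1] := by funext i; fin_cases i <;> rfl
  rw [hw'] at hw ⊢
  rcases (mem _ _).1 hw with h | h
  · exact (move1 _ _ a h).trans (move0 a _ _ ha)
  · exact (move0 _ _ a h).trans (move1 a _ _ ha)

/-! ### Closed choice reduces to connected choice in dimension at least three -/

/-- Index of the value of a rational point of the unit interval. -/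
def ratClamp (k : ℕ) : ℕ := ratMin (Nat.pair 1 0) k

theorem nnRat_ratClamp (k : ℕ) : nnRat (ratClamp k) = ((pt k : unitInterval) : ℝ) := by
  change _ = (ratPoint k : ℝ)
  rw [ratClamp, nnRat_ratMin]; simp [ratPoint]

theorem primrec_ratClamp : Primrec ratClamp := primrec_ratMin.comp (.const _) .id

theorem abs_coord_sub_le {n : ℕ} (x : Cube n) (c : ℕ) (i : Fin n) :
    |(x i : ℝ) - nnRat (ratClamp (coordIndex c i))| ≤ dist x (pt c) := by
  rw [nnRat_ratClamp, ← pt_cube_apply, ← Real.dist_eq, ← Subtype.dist_eq]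
  exact dist_le_pi_dist _ _ _

open Primrec in
-- The complement of the thickening is the union of the open sets `x ∉ A, z < 1` and `y ∉ A, 0 < z`,
-- and balls inside either one can be recognized from the balls removed from the interval.
theorem exists_computable_thickening {n : ℕ} (e : Fin 3 → Fin n) :
    ∃ H : Baire → Baire, ComputableFun (total H) ∧ ∀ p, (negMap (Cube n) (H p) : Set (Cube n)) =
      (fun x : Cube n => (x ∘ e : Cube 3)) ⁻¹' thickening (negMap unitInterval p) := by
  obtain ⟨D, hD, hd⟩ := effectiveMetric_unitInterval
  let ctr : ℕ → ℕ := fun n => n.unpair.2.unpair.2.unpair.1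
  let prec : ℕ → ℕ := fun n => n.unpair.2.unpair.2.unpair.2
  -- Here `n` codes a side (0 or 1 for the two open sets), a list position, a center and a
  -- precision; `b` is the listed ball.
  let T : ℕ → ℕ → Prop := fun b n =>
    (n.unpair.1 = 0 ∧
      ratLe (ratAdd (D (coordIndex (ctr n) (e 0)) b.unpair.1) (ratHalfPow (prec n))) b.unpair.2 ∧
      ratLe (ratAdd (ratClamp (coordIndex (ctr n) (e 2))) (ratHalfPow (prec n))) (Nat.pair 1 0)) ∨
    (n.unpair.1 = 1 ∧
      ratLe (ratAdd (D (coordIndex (ctr n) (e 1)) b.unpair.1) (ratHalfPow (prec n))) b.unpair.2 ∧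
      ratLe (ratHalfPow (prec n)) (ratClamp (coordIndex (ctr n) (e 2))))
  have hu : Primrec fun n : ℕ => n.unpair.2 := snd.comp .unpair
  have hctr : Primrec ctr := fst.comp (Primrec.unpair.comp (hu.comp hu))
  have hprec : Primrec prec := hu.comp (hu.comp hu)
  have hT : PrimrecRel T := by
    have hb2 : Primrec fun a : ℕ × ℕ => a.1.unpair.2 := hu.comp fst
    have hh : Primrec fun a : ℕ × ℕ => ratHalfPow (prec a.2) :=
      primrec_ratHalfPow.comp (hprec.comp snd)
    have hcoord : ∀ j : ℕ, Primrec fun a : ℕ × ℕ => coordIndex (ctr a.2) j := fun j =>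
      primrec_coordIndex.comp (hctr.comp snd) (.const j)
    have hdist : ∀ j : ℕ, PrimrecPred fun a : ℕ × ℕ =>
        ratLe (ratAdd (D (coordIndex (ctr a.2) j) a.1.unpair.1) (ratHalfPow (prec a.2)))
          a.1.unpair.2 := fun j =>
      primrecRel_ratLe.comp (primrec_ratAdd.comp
        (hD.comp (hcoord j) (fst.comp (Primrec.unpair.comp fst))) hh) hb2
    have hside : ∀ j : ℕ, PrimrecPred fun a : ℕ × ℕ => a.2.unpair.1 = j := fun j =>
      Primrec.eq.comp (fst.comp (Primrec.unpair.comp snd)) (.const j)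
    have hlast := primrec_ratClamp.comp (hcoord (e 2))
    exact ((hside 0).and ((hdist _).and
      (primrecRel_ratLe.comp (primrec_ratAdd.comp hlast hh) (.const _)))).or
      ((hside 1).and ((hdist _).and (primrecRel_ratLe.comp hh hlast)))
  classical
  let g : ℕ → ℕ → ℕ := fun b n => if T b n then Nat.pair (ctr n) (ratHalfPow (prec n)) else 0
  have hg : Primrec₂ g :=
    Primrec.ite hT (Primrec₂.natPair.comp (hctr.comp snd)
      (primrec_ratHalfPow.comp (hprec.comp snd))) (.const 0)
  have hj : Primrec fun n : ℕ => n.unpair.2.unpair.1 := fst.comp (Primrec.unpair.comp hu)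
  refine ⟨fun p n => g (p n.unpair.2.unpair.1) n,
    computableFun_total_of_digit hg hj fun _ _ => rfl, fun p => ?_⟩
  ext x
  rw [mem_preimage, SetLike.mem_coe, ← not_iff_not, notMem_negMap_iff]
  have hthick : (x ∘ e : Cube 3) ∉ thickening (negMap unitInterval p) ↔
      (x (e 0) ∉ negMap unitInterval p ∧ x (e 2) ≠ 1) ∨
      (x (e 1) ∉ negMap unitInterval p ∧ x (e 2) ≠ 0) := by
    simp only [thickening, mem_ofPred_eq, Function.comp_apply, SetLike.mem_coe]
    tauto
  rw [hthick]
  constructor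
  · rintro ⟨n, hn⟩
    simp only [g] at hn
    split_ifs at hn with h
    · rw [Nat.unpair_pair, nnRat_ratHalfPow] at hn
      have h2 := abs_le.1 (abs_coord_sub_le x (ctr n) (e 2))
      simp only [T, ratLe_iff, nnRat_ratAdd, nnRat_ratHalfPow, nnRat_natCast, hd] at h
      have near : ∀ i, dist (pt (coordIndex (ctr n) (e i)) : unitInterval)
          (pt (p n.unpair.2.unpair.1).unpair.1) + (1 / 2) ^ prec n ≤
          nnRat (p n.unpair.2.unpair.1).unpair.2 → x (e i) ∉ negMap unitInterval p := by
        intro i hi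
        refine notMem_negMap_iff.2 ⟨n.unpair.2.unpair.1, ?_⟩
        have h3 := dist_le_pi_dist x (pt (ctr n)) (e i)
        rw [pt_cube_apply] at h3
        have h4 := dist_triangle (x (e i)) (pt (coordIndex (ctr n) (e i)))
          (pt (p n.unpair.2.unpair.1).unpair.1)
        linarith
      rcases h with ⟨-, h, h'⟩ | ⟨-, h, h'⟩
      · refine Or.inl ⟨near 0 h, fun hx => ?_⟩
        rw [hx, Icc.coe_one] at h2
        push_cast at h'
        linarith [h2.2]
      · refine Or.inr ⟨near 1 h, fun hx => ?_⟩
        rw [hx, Icc.coe_zero] at h2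
        linarith [h2.1]
    · rw [nnRat_unpair_zero] at hn
      exact absurd hn (not_lt.2 dist_nonneg)
  · have key : ∀ i, x (e i) ∉ negMap unitInterval p → ∀ ε : ℝ, 0 < ε → ∃ j c m : ℕ,
        dist x (pt c) < (1 / 2 : ℝ) ^ m ∧ 2 * (1 / 2 : ℝ) ^ m < ε ∧
        dist (pt (coordIndex c (e i)) : unitInterval) (pt (p j).unpair.1) + (1 / 2 : ℝ) ^ m ≤
          nnRat (p j).unpair.2 := by
      intro i hi ε hε
      obtain ⟨j, hj⟩ := notMem_negMap_iff.1 hi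
      obtain ⟨m, hm⟩ := exists_half_pow_lt (ε := min (ε / 2)
        ((nnRat (p j).unpair.2 - dist (x (e i)) (pt (p j).unpair.1)) / 2))
        (lt_min (by linarith) (by linarith))
      rw [lt_min_iff] at hm
      obtain ⟨c, hc⟩ := (DenseSequence.dense (X := Cube n)).exists_dist_lt x
        (show (0 : ℝ) < (1 / 2) ^ m by positivity)
      refine ⟨j, c, m, hc, by linarith, ?_⟩
      have h3 := dist_le_pi_dist x (pt c) (e i)
      rw [pt_cube_apply, dist_comm] at h3
      have h4 := dist_triangle (pt (coordIndex c (e i))) (x (e i)) (pt (p j).unpair.1)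
      linarith
    rintro (⟨h, h'⟩ | ⟨h, h'⟩)
    · have hlt : (x (e 2) : ℝ) < 1 := lt_of_le_of_ne (x (e 2)).2.2 fun hx => h' (Subtype.ext hx)
      obtain ⟨j, c, m, hc, hm, hj⟩ := key 0 h (1 - x (e 2)) (by linarith)
      refine ⟨Nat.pair 0 (Nat.pair j (Nat.pair c m)), ?_⟩
      have h2 := abs_le.1 (abs_coord_sub_le x c (e 2))
      simp only [g, T, ctr, prec, Nat.unpair_pair, ratLe_iff, nnRat_ratAdd, nnRat_ratHalfPow,
        nnRat_natCast, hd]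
      rw [if_pos]
      · rwa [Nat.unpair_pair, nnRat_ratHalfPow]
      · refine Or.inl ⟨trivial, hj, ?_⟩
        push_cast
        linarith [h2.1]
    · have hlt : 0 < (x (e 2) : ℝ) := lt_of_le_of_ne (x (e 2)).2.1
        fun hx => h' (Subtype.ext hx.symm)
      obtain ⟨j, c, m, hc, hm, hj⟩ := key 1 h (x (e 2)) hlt
      refine ⟨Nat.pair 1 (Nat.pair j (Nat.pair c m)), ?_⟩
      have h2 := abs_le.1 (abs_coord_sub_le x c (e 2))
      simp only [g, T, ctr, prec, Nat.unpair_pair, ratLe_iff, nnRat_ratAdd, nnRat_ratHalfPow,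
        nnRat_natCast, hd]
      rw [if_pos]
      · rwa [Nat.unpair_pair, nnRat_ratHalfPow]
      · refine Or.inr ⟨trivial, hj, ?_⟩
        linarith [h2.2]

theorem IsCauchyName.apply {n : ℕ} {q : Baire} {x : Cube n} (h : IsCauchyName q x) (j : Fin n) :
    IsCauchyName (fun k => coordIndex (q k) j) (x j) := by
  refine ⟨fun i k hik => ?_, tendsto_pi_nhds.1 h.2 j⟩
  rw [← pt_cube_apply, ← pt_cube_apply]
  exact (dist_le_pi_dist _ _ j).trans (h.1 i k hik)

open Primrec in
theorem closedChoice_wle_connectedChoice {n : ℕ} (hn : 3 ≤ n) :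
    WLE (closedChoice unitInterval) (connectedChoice n) := by
  let e : Fin 3 → Fin n := Fin.castLE hn
  obtain ⟨H, hH, hset⟩ := exists_computable_thickening e
  -- `b` will be `q 2`, which is within 1/4 of the point. An approximate third coordinate of at most
  -- 1/2 excludes the value 1, a larger one excludes 0.
  let sel : ℕ → ℕ → ℕ := fun b k =>
    if ratLe (ratClamp (coordIndex b (e 2))) (ratHalfPow 1) then coordIndex k (e 0)
    else coordIndex k (e 1)
  have hsel : Primrec₂ sel := Primrec.ite (primrecRel_ratLe.comp (primrec_ratClamp.comp
    (primrec_coordIndex.comp fst (.const _))) (.const _))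
    (primrec_coordIndex.comp snd (.const _)) (primrec_coordIndex.comp snd (.const _))
  have hodd : Primrec fun k : ℕ => 2 * k + 1 := nat_double_succ
  have hK : ComputableFun (total fun r k => sel (r (2 * 2 + 1)) (r (2 * k + 1))) :=
    computableFun_total (g := fun u k => sel (u.getD (2 * 2 + 1) 0) (u.getD (2 * k + 1) 0))
      (s := fun k => (2 * k + 1) + 6)
      (hsel.comp ((list_getD 0).comp fst (.const _)) ((list_getD 0).comp fst (hodd.comp snd)))
      (nat_add.comp hodd (.const 6)) fun p k m hm => by
        rw [getD_initSeg p (by omega), getD_initSeg p (by omega)]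
  refine WLE.of_total hH hK fun p A hA hne => ?_
  rw [mem_rep_closeds_iff] at hA
  subst hA
  have hconn : IsConnected (negMap (Cube n) (H p) : Set (Cube n)) := by
    rw [hset]
    exact isConnected_preimage_comp (Fin.castLE_injective hn) (isConnected_thickening hne)
  refine ⟨_, mem_rep_closeds_iff.2 rfl, connectedChoice_nonempty_iff.2 hconn, fun q x hq hx => ?_⟩
  have hxB : x ∈ (negMap (Cube n) (H p) : Set (Cube n)) := hx.2
  rw [hset] at hxB
  have hq := mem_rep_iff.1 hq
  have h2 := abs_le.1 ((abs_coord_sub_le x (q 2) (e 2)).trans (hq.dist_le 2))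
  rw [nnRat_ratClamp] at h2
  obtain ⟨h2, h3⟩ := h2
  have hx' : (x (e 0) ∈ negMap unitInterval p ∨ x (e 2) = 1) ∧
      (x (e 1) ∈ negMap unitInterval p ∨ x (e 2) = 0) := hxB
  by_cases hc : ratLe (ratClamp (coordIndex (q 2) (e 2))) (ratHalfPow 1)
  · have hname : (fun k => sel (pair p q (2 * 2 + 1)) (pair p q (2 * k + 1))) =
        fun k => coordIndex (q k) (e 0) := funext fun k => by
      rw [pair_odd, pair_odd]; exact if_pos hc
    refine ⟨x (e 0), ?_, hx'.1.resolve_right fun hx1 => ?_⟩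
    · rw [hname]
      exact mem_rep_iff.2 (hq.apply (e 0))
    · rw [ratLe_iff, nnRat_ratClamp, nnRat_ratHalfPow] at hc
      rw [hx1, Icc.coe_one] at h3
      norm_num at hc h3
      linarith
  · have hname : (fun k => sel (pair p q (2 * 2 + 1)) (pair p q (2 * k + 1))) =
        fun k => coordIndex (q k) (e 1) := funext fun k => by
      rw [pair_odd, pair_odd]; exact if_neg hc
    refine ⟨x (e 1), ?_, hx'.2.resolve_right fun hx1 => ?_⟩
    · rw [hname]
      exact mem_rep_iff.2 (hq.apply (e 1))
    · rw [ratLe_iff, nnRat_ratClamp, nnRat_ratHalfPow] at hc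
      rw [hx1, Icc.coe_zero] at h2
      norm_num at hc h2
      linarith

/-! ### Connected choice in dimension one is not computable -/

theorem not_connectedChoice_one_wle_zero : ¬ WLE (connectedChoice 1) (connectedChoice 0) := by
  rintro ⟨K, H, ⟨k, -, -, hk⟩, -, hKH⟩
  let z : Baire := fun _ => 0
  have hG : Realizes (total fun _ => z) (connectedChoice 0) := by
    rintro p A hA ⟨y, hy⟩
    refine ⟨z, mem_total.2 rfl, pt 0, mem_rep_iff.2 (isCauchyName_of_dist_le fun i => ?_), ?_⟩
    · simp [z]
    · rwa [Subsingleton.elim (pt 0 : Cube 0) y]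
  have key : ∀ p, IsConnected (negMap (Cube 1) p : Set (Cube 1)) →
      ∃ q ∈ K (pair p z), ∃ x ∈ negMap (Cube 1) p, IsCauchyName q x := by
    intro p hp
    obtain ⟨q, hq, x, hx, hxA⟩ := hKH _ hG p _ (mem_rep_closeds_iff.2 rfl)
      (connectedChoice_nonempty_iff.2 hp)
    obtain ⟨r, hr, hq⟩ := Part.mem_bind_iff.1 hq
    obtain ⟨s, hs, hq⟩ := Part.mem_bind_iff.1 hq
    rw [mem_total.1 hs] at hq
    exact ⟨q, hq, x, hxA.2, mem_rep_iff.1 hx⟩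
  have hz : (negMap (Cube 1) z : Set (Cube 1)) = univ := by
    refine eq_univ_of_forall fun x => mem_negMap_iff.2 fun i => ?_
    change nnRat (Nat.unpair 0).2 ≤ _
    rw [nnRat_unpair_zero]
    exact dist_nonneg
  obtain ⟨q, hq, x, -, hqx⟩ := key z (hz ▸ isConnected_univ)
  -- Four digits include the one of index 3, which fixes the answer up to 1/8; two answers sharing
  -- it are at distance at most 1/4, too close for points 1/2 apart.
  obtain ⟨m, hm⟩ := (hk _ q hq).2 4
  obtain ⟨t, ht⟩ : ∃ t : Cube 1, 1 / 2 ≤ dist x t := by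
    rcases le_total (x 0 : ℝ) (1 / 2) with h | h
    · refine ⟨fun _ => 1, le_trans ?_ (dist_le_pi_dist _ _ 0)⟩
      rw [Subtype.dist_eq, Real.dist_eq, Icc.coe_one]
      exact le_trans (by linarith) (neg_le_abs _)
    · refine ⟨fun _ => 0, le_trans ?_ (dist_le_pi_dist _ _ 0)⟩
      rw [Subtype.dist_eq, Real.dist_eq, Icc.coe_zero]
      exact le_trans (by linarith) (le_abs_self _)
  obtain ⟨r, hr⟩ := negMap_surjective (⟨{t}, isClosed_singleton⟩ : TopologicalSpace.Closeds (Cube 1))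
  -- The name of `{t}` is delayed by `m` empty balls, so that `K` cannot tell it from `z` on its
  -- first `m` inputs.
  let p : Baire := fun n => if n < m then 0 else r (n - m)
  have hp : (negMap (Cube 1) p : Set (Cube 1)) = {t} := by
    have hr' : (negMap (Cube 1) r : Set (Cube 1)) = {t} := by rw [hr]; rfl
    rw [← hr']
    ext y
    rw [SetLike.mem_coe, SetLike.mem_coe, mem_negMap_iff, mem_negMap_iff]
    constructor
    · intro h i
      simpa [p] using h (i + m)
    · intro h i
      by_cases hi : i < m
      · simp only [p, if_pos hi, nnRat_unpair_zero]
        exact dist_nonneg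
      · simp only [p, if_neg hi]
        exact h _
  obtain ⟨q', hq', x', hx', hqx'⟩ := key p (hp ▸ isConnected_singleton)
  have hx't : x' = t := by
    have : x' ∈ (negMap (Cube 1) p : Set (Cube 1)) := hx'
    rwa [hp] at this
  subst hx't
  obtain ⟨l, hl⟩ := (hk _ q' hq').1 m
  have hseg : initSeg (pair z z) m = initSeg (pair p z) m := initSeg_congr fun i hi => by
    have h : i / 2 < m := lt_of_le_of_lt (Nat.div_le_self i 2) hi
    simp [pair, p, z, h]
  rw [hseg, hl] at hm
  have h3 := eq_of_initSeg_prefix hm (show 3 < 4 by norm_num)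
  have h4 := hqx.dist_le 3
  have h5 := hqx'.dist_le 3
  rw [h3] at h4
  have h6 := dist_triangle_right x x' (pt (q' 3))
  norm_num at h4 h5
  linarith

/-! ### A co-c.e. closed set without computable points -/

open Nat.Partrec in
/-- An enumeration of balls: if the `e`-th partial computable function halts on `e + 4` with value
`k`, then the ball around the `k`-th point with radius `2^{-(e+3)}` is listed. -/
def singularCover (n : ℕ) : ℕ :=
  ((Code.evaln n.unpair.2 (Denumerable.ofNat Code n.unpair.1) (n.unpair.1 + 4)).map
    fun k => Nat.pair k (ratHalfPow (n.unpair.1 + 3))).getD 0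

open Primrec in
theorem primrec_singularCover : Primrec singularCover := by
  have h1 : Primrec fun n : ℕ => n.unpair.1 := fst.comp .unpair
  have h2 : Primrec fun n : ℕ => n.unpair.2 := snd.comp .unpair
  exact option_getD.comp (option_map (Nat.Partrec.Code.primrec_evaln.comp
    ((h2.pair ((Primrec.ofNat Nat.Partrec.Code).comp h1)).pair (nat_add.comp h1 (.const 4))))
    (Primrec₂.natPair.comp snd (primrec_ratHalfPow.comp (nat_add.comp (h1.comp fst) (.const 3)))))
    (.const 0)

/-- A co-c.e. closed set without computable points. -/
def singularSet : TopologicalSpace.Closeds unitInterval := negMap unitInterval singularCover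

theorem isComputablePoint_singularSet : IsComputablePoint singularSet :=
  ⟨_, primrec_singularCover.to_comp, mem_rep_closeds_iff.2 rfl⟩

/-- If `e` codes a computable name of `x`, its digit at `e + 4` gives a point within `2^{-(e+4)}` of
`x`, so the ball of twice that radius listed for `e` removes `x`. -/
theorem not_isComputablePoint_of_mem_singularSet {x : unitInterval} (hx : x ∈ singularSet) :
    ¬ IsComputablePoint x := by
  rintro ⟨r, hr, hrx⟩
  rw [mem_rep_iff] at hrx
  obtain ⟨c, hc⟩ := Nat.Partrec.Code.exists_code.1 (Partrec.nat_iff.1 hr.partrec)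
  set e := Encodable.encode c with he
  have hmem : r (e + 4) ∈ Nat.Partrec.Code.eval c (e + 4) := by rw [hc]; exact Part.mem_some _
  obtain ⟨s, hs⟩ := Nat.Partrec.Code.evaln_complete.1 hmem
  have h1 := mem_negMap_iff.1 hx (Nat.pair e s)
  have h2 : singularCover (Nat.pair e s) = Nat.pair (r (e + 4)) (ratHalfPow (e + 3)) := by
    simp only [singularCover, Nat.unpair_pair, he, Denumerable.ofNat_encode]
    rw [← he, Option.mem_def.1 hs]
    rfl
  rw [h2, Nat.unpair_pair, nnRat_ratHalfPow] at h1
  have h3 := hrx.dist_le (e + 4)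
  have h4 : (0 : ℝ) < (1 / 2 : ℝ) ^ (e + 3) := by positivity
  rw [show e + 4 = (e + 3) + 1 by ring, pow_succ] at h3
  linarith

open MeasureTheory in
-- Each `e` contributes at most one nonempty ball, since a halting computation has the same value
-- for every step bound. The total length is at most the sum of `2 * 2^{-(e+3)}`, that is 1/2, so
-- the interval is not covered.
theorem singularSet_nonempty : (singularSet : Set unitInterval).Nonempty := by
  by_contra hempty
  rw [Set.not_nonempty_iff_eq_empty] at hempty
  classical
  let c : ℕ → ℝ := fun e =>
    if h : (Nat.Partrec.Code.eval (Denumerable.ofNat Nat.Partrec.Code e) (e + 4)).Dom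
    then ratPoint (Part.get _ h) else 0
  have hcover : Icc (0 : ℝ) 1 ⊆ ⋃ e, Metric.ball (c e) ((1 / 2 : ℝ) ^ (e + 3)) := by
    intro x hx
    have hx' : (⟨x, hx⟩ : unitInterval) ∉ singularSet := fun h => by
      have : (⟨x, hx⟩ : unitInterval) ∈ (singularSet : Set unitInterval) := h
      rw [hempty] at this
      exact this
    obtain ⟨n, hn⟩ := notMem_negMap_iff.1 hx'
    simp only [singularCover] at hn
    rcases hev : Nat.Partrec.Code.evaln n.unpair.2
      (Denumerable.ofNat Nat.Partrec.Code n.unpair.1) (n.unpair.1 + 4) with _ | k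
    · rw [hev, Option.map_none, Option.getD_none, nnRat_unpair_zero] at hn
      exact absurd hn (not_lt.2 dist_nonneg)
    · rw [hev, Option.map_some, Option.getD_some, Nat.unpair_pair, nnRat_ratHalfPow] at hn
      refine mem_iUnion.2 ⟨n.unpair.1, ?_⟩
      have hk := Nat.Partrec.Code.evaln_sound (Option.mem_def.2 hev)
      have hc : c n.unpair.1 = ratPoint k := by
        obtain ⟨hd, hk⟩ := hk
        simp only [c, dif_pos hd, hk]
      rw [Metric.mem_ball, hc]
      exact hn
  have hsum : HasSum (fun e : ℕ => 2 * (1 / 2 : ℝ) ^ (e + 3)) (1 / 2) := by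
    have h := hasSum_geometric_two.mul_right (1 / 4 : ℝ)
    have he : (fun e : ℕ => (1 / 2 : ℝ) ^ e * (1 / 4)) = fun e => 2 * (1 / 2) ^ (e + 3) :=
      funext fun e => by ring
    rw [he] at h
    norm_num at h ⊢
    exact h
  have hvol : volume (Icc (0 : ℝ) 1) ≤ ENNReal.ofReal (1 / 2) := by
    refine (measure_mono hcover).trans ((measure_iUnion_le _).trans_eq ?_)
    simp only [Real.volume_ball]
    rw [← ENNReal.ofReal_tsum_of_nonneg (fun _ => by positivity) hsum.summable, hsum.tsum_eq]
  rw [Real.volume_Icc, ENNReal.ofReal_le_ofReal_iff (by norm_num)] at hvol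
  norm_num at hvol

theorem not_isComputablePoint_of_mem_mixedCube {x : Cube 2} (hx : x ∈ mixedCube singularSet) :
    ¬ IsComputablePoint x := by
  rintro ⟨q, hq, hqx⟩
  rw [mem_rep_iff] at hqx
  have hcoord : ∀ j : Fin 2, IsComputablePoint (x j) := fun j =>
    ⟨_, primrec_coordIndex.to_comp.comp hq (.const _), mem_rep_iff.2 (hqx.apply j)⟩
  rcases hx with h | h
  · exact not_isComputablePoint_of_mem_singularSet h (hcoord 0)
  · exact not_isComputablePoint_of_mem_singularSet h (hcoord 1)

open Primrec in
-- The complement of the mixed cube is the square of the complement of `A`, so it is exhausted by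
-- balls whose two projections lie in two listed balls.
theorem isComputablePoint_mixedCube {A : TopologicalSpace.Closeds unitInterval}
    (hA : IsComputablePoint A) : IsComputablePoint (mixedCube A) := by
  obtain ⟨p, hp, hpA⟩ := hA
  rw [mem_rep_closeds_iff] at hpA
  subst hpA
  obtain ⟨D, hD, hd⟩ := effectiveMetric_unitInterval
  let T : ℕ → ℕ → ℕ → ℕ → Prop := fun j b c i =>
    ratLe (ratAdd (D (coordIndex c j) b.unpair.1) (ratHalfPow i)) b.unpair.2
  have hT : ∀ (j : ℕ) {α : Type} [Primcodable α] {b c i : α → ℕ}, Primrec b → Primrec c →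
      Primrec i → PrimrecPred fun a => T j (b a) (c a) (i a) := fun j _ _ _ _ _ hb hc hi =>
    primrecRel_ratLe.comp (primrec_ratAdd.comp (hD.comp (primrec_coordIndex.comp hc (.const j))
      (fst.comp (Primrec.unpair.comp hb))) (primrec_ratHalfPow.comp hi))
      (snd.comp (Primrec.unpair.comp hb))
  let g : (ℕ × ℕ) × ℕ → ℕ := fun a =>
    if T 0 a.1.1 a.2.unpair.1 a.2.unpair.2 ∧ T 1 a.1.2 a.2.unpair.1 a.2.unpair.2
    then Nat.pair a.2.unpair.1 (ratHalfPow a.2.unpair.2) else 0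
  have hc : Primrec fun a : (ℕ × ℕ) × ℕ => a.2.unpair.1 := fst.comp (Primrec.unpair.comp snd)
  have hi : Primrec fun a : (ℕ × ℕ) × ℕ => a.2.unpair.2 := snd.comp (Primrec.unpair.comp snd)
  have hg : Primrec g := Primrec.ite ((hT 0 (fst.comp fst) hc hi).and (hT 1 (snd.comp fst) hc hi))
    (Primrec₂.natPair.comp hc (primrec_ratHalfPow.comp hi)) (.const 0)
  have h1 : Primrec fun n : ℕ => n.unpair.1.unpair.1 := fst.comp (Primrec.unpair.comp (fst.comp .unpair))
  have h2 : Primrec fun n : ℕ => n.unpair.1.unpair.2 := snd.comp (Primrec.unpair.comp (fst.comp .unpair))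
  have h3 : Primrec fun n : ℕ => n.unpair.2 := snd.comp .unpair
  refine ⟨fun n => g ((p n.unpair.1.unpair.1, p n.unpair.1.unpair.2), n.unpair.2),
    hg.to_comp.comp (((hp.comp h1.to_comp).pair (hp.comp h2.to_comp)).pair h3.to_comp),
    mem_rep_closeds_iff.2 ?_⟩
  refine TopologicalSpace.Closeds.ext (Set.ext fun x => ?_)
  rw [SetLike.mem_coe, SetLike.mem_coe, ← not_iff_not, notMem_negMap_iff]
  have hmix : x ∉ mixedCube (negMap unitInterval p) ↔
      x 0 ∉ negMap unitInterval p ∧ x 1 ∉ negMap unitInterval p := not_or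
  rw [hmix]
  constructor
  · rintro ⟨h0, h1⟩
    obtain ⟨j, hj⟩ := notMem_negMap_iff.1 h0
    obtain ⟨l, hl⟩ := notMem_negMap_iff.1 h1
    obtain ⟨i, hi⟩ := exists_half_pow_lt (ε := min
      ((nnRat (p j).unpair.2 - dist (x 0) (pt (p j).unpair.1)) / 2)
      ((nnRat (p l).unpair.2 - dist (x 1) (pt (p l).unpair.1)) / 2))
      (lt_min (by linarith) (by linarith))
    rw [lt_min_iff] at hi
    obtain ⟨c, hc⟩ := (DenseSequence.dense (X := Cube 2)).exists_dist_lt x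
      (show (0 : ℝ) < (1 / 2) ^ i by positivity)
    refine ⟨Nat.pair (Nat.pair j l) (Nat.pair c i), ?_⟩
    have near : ∀ (e : Fin 2) (u : unitInterval),
        dist (pt (coordIndex c e)) u ≤ (1 / 2) ^ i + dist (x e) u := fun e u => by
      have h3 := dist_le_pi_dist x (pt c) e
      rw [pt_cube_apply] at h3
      have h4 := dist_triangle_left (pt (coordIndex c e)) u (x e)
      linarith
    simp only [g, T, Nat.unpair_pair, ratLe_iff, nnRat_ratAdd, nnRat_ratHalfPow, hd]
    rw [if_pos]
    · rwa [Nat.unpair_pair, nnRat_ratHalfPow]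
    · have h5 := near 0 (pt (p j).unpair.1)
      have h6 := near 1 (pt (p l).unpair.1)
      simp only [Fin.val_zero, Fin.val_one] at h5 h6
      constructor <;> linarith [hi.1, hi.2]
  · rintro ⟨n, hn⟩
    simp only [g] at hn
    split_ifs at hn with h
    · rw [Nat.unpair_pair, nnRat_ratHalfPow] at hn
      simp only [T, ratLe_iff, nnRat_ratAdd, nnRat_ratHalfPow, hd] at h
      have near : ∀ (e : Fin 2) (u : unitInterval),
          dist (x e) u < (1 / 2) ^ n.unpair.2.unpair.2 +
            dist (pt (coordIndex n.unpair.2.unpair.1 e)) u := fun e u => by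
        have h3 := dist_le_pi_dist x (pt n.unpair.2.unpair.1) e
        rw [pt_cube_apply] at h3
        have h4 := dist_triangle (x e) (pt (coordIndex n.unpair.2.unpair.1 e)) u
        linarith
      have h5 := near 0 (pt (p n.unpair.1.unpair.1).unpair.1)
      have h6 := near 1 (pt (p n.unpair.1.unpair.2).unpair.1)
      simp only [Fin.val_zero, Fin.val_one] at h5 h6
      exact ⟨notMem_negMap_iff.2 ⟨n.unpair.1.unpair.1, by linarith [h.1]⟩,
        notMem_negMap_iff.2 ⟨n.unpair.1.unpair.2, by linarith [h.2]⟩⟩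
    · rw [nnRat_unpair_zero] at hn
      exact absurd hn (not_lt.2 dist_nonneg)

theorem not_connectedChoice_two_nonuniformlyComputable :
    ¬ NonuniformlyComputable (connectedChoice 2) := by
  intro h
  obtain ⟨x, hx, hxc⟩ := h (mixedCube singularSet)
    (isComputablePoint_mixedCube isComputablePoint_singularSet)
    (connectedChoice_nonempty_iff.2 (isConnected_mixedCube singularSet_nonempty))
  exact not_isComputablePoint_of_mem_mixedCube hx.2 hxc

/-! ### Connected choice in dimension one is non-uniformly computable -/

/-- Index of the `a`-th point of the grid of mesh `1 / (N + 1)`. -/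
def gridIndex (a N : ℕ) : ℕ := cubeIndex fun _ : Fin 1 => Nat.pair a N

theorem primrec_gridIndex : Primrec₂ gridIndex :=
  primrec_cubeIndex fun _ => Primrec₂.natPair.comp .fst .snd

theorem exists_dist_grid_lt (x : Cube 1) (N : ℕ) :
    ∃ a < N + 2, dist x (pt (gridIndex a N)) < 1 / ((N : ℝ) + 1) := by
  have hN : (0 : ℝ) < (N : ℝ) + 1 := by positivity
  have h0 := (x 0).2.1
  have h1 := (x 0).2.2
  have h2 := Nat.floor_le (mul_nonneg h0 hN.le)
  have h3 := Nat.lt_floor_add_one ((x 0 : ℝ) * ((N : ℝ) + 1))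
  set a := ⌊(x 0 : ℝ) * ((N : ℝ) + 1)⌋₊
  have h4 : (a : ℝ) / ((N : ℝ) + 1) ≤ x 0 := by rwa [div_le_iff₀ hN]
  have h5 : (x 0 : ℝ) < (a : ℝ) / ((N : ℝ) + 1) + 1 / ((N : ℝ) + 1) := by
    rw [← add_div, lt_div_iff₀ hN]; exact h3
  refine ⟨a, ?_, ?_⟩
  · have h6 : (a : ℝ) ≤ (N : ℝ) + 1 := h2.trans (mul_le_of_le_one_left hN.le h1)
    have h7 : a ≤ N + 1 := by exact_mod_cast h6
    omega
  · refine (dist_pi_lt_iff (by positivity)).2 fun i => ?_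
    rw [Subsingleton.elim i 0, pt_cube_apply, gridIndex, coordIndex_cubeIndex, Subtype.dist_eq]
    change dist (x 0 : ℝ) (min 1 (nnRat _)) < _
    rw [nnRat_pair, min_eq_right (h4.trans h1), Real.dist_eq, abs_of_nonneg (by linarith)]
    linarith

/-- A small ball around a rational point contains `x` as soon as it covers the cube together with
finitely many removed balls. By compactness such a cover exists at every precision, and it can be
found by search, being verifiable on a finite grid. -/
theorem isComputablePoint_of_isComputablePoint_singleton {x : Cube 1}
    {A : TopologicalSpace.Closeds (Cube 1)} (hA : IsComputablePoint A)
    (hx : (A : Set (Cube 1)) = {x}) : IsComputablePoint x := by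
  obtain ⟨p, hp, hpA⟩ := hA
  rw [mem_rep_closeds_iff] at hpA
  subst hpA
  have hxp : ∀ y, y ∈ negMap (Cube 1) p ↔ y = x := fun y => by
    rw [← SetLike.mem_coe, hx, mem_singleton_iff]
  obtain ⟨D, hD, hd⟩ := effectiveMetric_cube 1
  let S : ℕ → ℕ → ℕ → Prop := fun b a N =>
    ratLe (ratAdd (D (gridIndex a N) b.unpair.1) (Nat.pair 1 N)) b.unpair.2
  have hS_iff : ∀ b a N, S b a N ↔
      dist (pt (gridIndex a N) : Cube 1) (pt b.unpair.1) + 1 / ((N : ℝ) + 1) ≤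
        nnRat b.unpair.2 := fun b a N => by
    simp only [S, ratLe_iff, nnRat_ratAdd, hd]
    rw [nnRat_pair, Nat.cast_one]
  have hS : ∀ {α : Type} [Primcodable α] {b a N : α → ℕ}, Primrec b → Primrec a → Primrec N →
      PrimrecPred fun s => S (b s) (a s) (N s) := fun hb ha hN =>
    primrecRel_ratLe.comp (primrec_ratAdd.comp (hD.comp (primrec_gridIndex.comp ha hN)
      (Primrec.fst.comp (Primrec.unpair.comp hb))) (Primrec₂.natPair.comp (.const 1) hN))
      (Primrec.snd.comp (Primrec.unpair.comp hb))
  -- For `y = ((i, ⟨k, N⟩), l)`, the ball of radius `1 / (N + 1)` around the grid point `a` fits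
  -- into the candidate ball around `pt k` or into a removed ball from `l`.
  let Q : ℕ → (ℕ × ℕ) × List ℕ → Prop := fun a y =>
    S (Nat.pair y.1.2.unpair.1 (ratHalfPow (y.1.1 + 1))) a y.1.2.unpair.2 ∨
      ∃ b ∈ y.2, S b a y.1.2.unpair.2
  have hQ : PrimrecRel Q := by
    have h1 : Primrec fun s : ℕ × (ℕ × ℕ) × List ℕ => s.2.1.2.unpair :=
      Primrec.unpair.comp (Primrec.snd.comp (Primrec.fst.comp .snd))
    have h2 : Primrec fun s : ℕ × (ℕ × ℕ) × List ℕ => ratHalfPow (s.2.1.1 + 1) :=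
      primrec_ratHalfPow.comp (Primrec.succ.comp (Primrec.fst.comp (Primrec.fst.comp .snd)))
    have h3 : PrimrecRel fun (b : ℕ) (s : ℕ × (ℕ × ℕ) × List ℕ) => S b s.1 s.2.1.2.unpair.2 :=
      hS .fst (Primrec.fst.comp .snd) (Primrec.snd.comp (h1.comp .snd))
    exact (hS (Primrec₂.natPair.comp (Primrec.fst.comp h1) h2) .fst (Primrec.snd.comp h1)).or
      (h3.exists_mem_list.comp (Primrec.snd.comp .snd) .id)
  let R : (ℕ × ℕ) × List ℕ → Prop := fun y => ∀ a ∈ List.range (y.1.2.unpair.2 + 2), Q a y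
  have hR : PrimrecPred R := hQ.forall_mem_list.comp (Primrec.list_range.comp
    (Primrec.nat_add.comp (Primrec.snd.comp (Primrec.unpair.comp (Primrec.snd.comp .fst)))
      (.const 2))) .id
  classical
  have hRc : Computable₂ fun i w : ℕ => decide (R ((i, w), initSeg p w.unpair.2)) :=
    hR.decide.to_comp.comp ((Computable.fst.pair .snd).pair
      ((computable_initSeg hp).comp (Computable.snd.comp (Computable.unpair.comp .snd))))
  have hex : ∀ i, ∃ w, decide (R ((i, w), initSeg p w.unpair.2)) = true := by
    intro i
    obtain ⟨k, hk⟩ := (DenseSequence.dense (X := Cube 1)).exists_dist_lt x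
      (show (0 : ℝ) < (1 / 2) ^ (i + 1) by positivity)
    -- The parameter `N` governs both the margin and the number of removed balls used. The sets
    -- increase with `N`, so compactness yields a single `N` for the whole cube.
    let V : ℕ → Set (Cube 1) := fun N =>
      {y | dist y (pt k) + 1 / ((N : ℝ) + 1) < (1 / 2) ^ (i + 1)} ∪
        ⋃ j ∈ Finset.range N, {y | dist y (pt (p j).unpair.1) + 1 / ((N : ℝ) + 1) <
          nnRat (p j).unpair.2}
    have hVo : ∀ N, IsOpen (V N) := fun N =>
      (isOpen_lt (by fun_prop) (by fun_prop)).union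
        (isOpen_biUnion fun j _ => isOpen_lt (by fun_prop) (by fun_prop))
    have hVm : Monotone V := by
      intro M N hMN
      have h : 1 / ((N : ℝ) + 1) ≤ 1 / ((M : ℝ) + 1) := by gcongr
      have hsub : ∀ (u : Cube 1) (r : ℝ), {y | dist y u + 1 / ((M : ℝ) + 1) < r} ⊆
          {y | dist y u + 1 / ((N : ℝ) + 1) < r} := fun u r y hy => by
        rw [mem_ofPred_eq] at hy ⊢
        linarith
      refine union_subset_union (hsub _ _) ?_
      refine iUnion₂_subset fun j hj y hy => mem_iUnion₂.2 ⟨j, ?_, hsub _ _ hy⟩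
      exact Finset.mem_range.2 ((Finset.mem_range.1 hj).trans_le hMN)
    have hVc : (univ : Set (Cube 1)) ⊆ ⋃ N, V N := by
      intro y _
      by_cases hy : y = x
      · subst hy
        obtain ⟨N, hN⟩ := exists_nat_one_div_lt (sub_pos.2 hk)
        exact mem_iUnion.2 ⟨N, Or.inl (by rw [mem_ofPred_eq]; linarith)⟩
      · obtain ⟨j, hj⟩ := notMem_negMap_iff.1 (fun h => hy ((hxp y).1 h))
        obtain ⟨N, hN⟩ := exists_nat_one_div_lt (sub_pos.2 hj)
        have h : 1 / (((N + j + 1 : ℕ) : ℝ) + 1) ≤ 1 / ((N : ℝ) + 1) := by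
          push_cast
          gcongr
          have : (0 : ℝ) ≤ j := Nat.cast_nonneg j
          linarith
        -- This index keeps the margin below that of `N` and includes the `j`-th ball.
        refine mem_iUnion.2 ⟨N + j + 1, Or.inr (mem_iUnion₂.2 ⟨j, ?_, ?_⟩)⟩
        · exact Finset.mem_range.2 (by omega)
        · rw [mem_ofPred_eq]
          linarith
    obtain ⟨N, hN⟩ := isCompact_univ.elim_directed_cover V hVo hVc hVm.directed_le
    refine ⟨Nat.pair k N, decide_eq_true fun a _ => ?_⟩
    simp only [Q, Nat.unpair_pair, hS_iff]
    rcases hN (mem_univ (pt (gridIndex a N))) with h | h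
    · left
      rw [nnRat_ratHalfPow]
      exact le_of_lt h
    · obtain ⟨j, hj, h⟩ := mem_iUnion₂.1 h
      exact Or.inr ⟨p j, List.mem_map.2 ⟨j, List.mem_range.2 (Finset.mem_range.1 hj), rfl⟩,
        le_of_lt h⟩
  obtain ⟨g, hg, hgR⟩ := exists_computable_of_forall_exists hRc hex
  refine ⟨fun i => (g i).unpair.1, Computable.fst.comp (Computable.unpair.comp hg),
    mem_rep_iff.2 (isCauchyName_of_dist_le fun i => ?_)⟩
  have hRi := of_decide_eq_true (hgR i)
  obtain ⟨a, ha, hax⟩ := exists_dist_grid_lt x (g i).unpair.2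
  have hQa := hRi a (List.mem_range.2 ha)
  simp only [Q, hS_iff, Nat.unpair_pair, nnRat_ratHalfPow] at hQa
  rcases hQa with h | ⟨b, hb, h⟩
  · have := dist_triangle x (pt (gridIndex a (g i).unpair.2)) (pt (g i).unpair.1)
    linarith
  · obtain ⟨j, -, rfl⟩ := List.mem_map.1 hb
    have h1 := mem_negMap_iff.1 ((hxp x).2 rfl) j
    have := dist_triangle x (pt (gridIndex a (g i).unpair.2)) (pt (p j).unpair.1)
    linarith

/-- Two distinct points of a connected set enclose a rational one that also belongs to it; without
rational points the set is therefore a singleton. -/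
theorem nonuniformlyComputable_connectedChoice_one :
    NonuniformlyComputable (connectedChoice 1) := by
  intro A hA hne
  have hconn := connectedChoice_nonempty_iff.1 hne
  by_cases hrat : ∃ k, pt k ∈ A
  · obtain ⟨k, hk⟩ := hrat
    exact ⟨pt k, ⟨hconn, hk⟩, isComputablePoint_pt k⟩
  obtain ⟨x, hx⟩ := hconn.nonempty
  have key : ∀ y ∈ A, ∀ z ∈ A, ¬ (y 0 : ℝ) < z 0 := by
    intro y hy z hz hyz
    obtain ⟨k, hk⟩ := (DenseSequence.dense (X := unitInterval)).exists_dist_lt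
      (⟨((y 0 : ℝ) + z 0) / 2, by
        have h1 := (y 0).2.1
        have h2 := (z 0).2.2
        constructor <;> linarith⟩ : unitInterval) (show 0 < ((z 0 : ℝ) - y 0) / 2 by linarith)
    rw [Subtype.dist_eq, Real.dist_eq, abs_lt] at hk
    dsimp only at hk
    have himage := (hconn.isPreconnected.image (fun w : Cube 1 => (w 0 : ℝ))
      (by fun_prop)).Icc_subset (mem_image_of_mem _ hy) (mem_image_of_mem _ hz)
    obtain ⟨w, hw, hwk⟩ := himage (show ((pt k : unitInterval) : ℝ) ∈ Icc _ _ from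
      ⟨by linarith [hk.2], by linarith [hk.1]⟩)
    refine hrat ⟨cubeIndex fun _ : Fin 1 => k, ?_⟩
    have hwp : (pt (cubeIndex fun _ : Fin 1 => k) : Cube 1) = w := by
      funext i
      rw [pt_cube_apply, coordIndex_cubeIndex, Subsingleton.elim i 0]
      exact Subtype.ext hwk.symm
    rw [hwp]
    exact hw
  have hsing : (A : Set (Cube 1)) = {x} := by
    refine Subset.antisymm (fun y hy => ?_) (singleton_subset_iff.2 hx)
    refine mem_singleton_iff.2 (funext fun i => ?_)
    rw [Subsingleton.elim i 0]
    exact Subtype.ext (le_antisymm (not_lt.1 (key x hx y hy)) (not_lt.1 (key y hy x hx)))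
  exact ⟨x, ⟨hconn, hx⟩, isComputablePoint_of_isComputablePoint_singleton hA hsing⟩

end WeihrauchLattice

end

theorem proposition5p8 :
    WLT (connectedChoice 0) (connectedChoice 1) ∧
    WLT (connectedChoice 1) (connectedChoice 2) ∧
    (∀ n : ℕ, 3 ≤ n →
      WLE (connectedChoice 2) (connectedChoice n) ∧
      WEquiv (connectedChoice n) (closedChoice unitInterval)) ∧
    (∃ A : TopologicalSpace.Closeds unitInterval,
      (A : Set unitInterval).Nonempty ∧ IsComputablePoint A ∧
      IsComputablePoint (mixedCube A) ∧ IsConnected (mixedCube A : Set (Cube 2)) ∧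
      ∀ x ∈ mixedCube A, ¬ IsComputablePoint x) ∧
    NonuniformlyComputable (connectedChoice 1) := by
  exact ⟨⟨connectedChoice_wle_of_le zero_le_one, not_connectedChoice_one_wle_zero⟩,
    ⟨connectedChoice_wle_of_le one_le_two, fun h =>
      not_connectedChoice_two_nonuniformlyComputable
        (h.nonuniformlyComputable nonuniformlyComputable_connectedChoice_one)⟩,
    fun n hn => ⟨connectedChoice_wle_of_le (by omega), connectedChoice_wle_closedChoice n,
      closedChoice_wle_connectedChoice hn⟩,
    ⟨singularSet, singularSet_nonempty, isComputablePoint_singularSet,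
      isComputablePoint_mixedCube isComputablePoint_singularSet,
      isConnected_mixedCube singularSet_nonempty,
      fun _ hx => not_isComputablePoint_of_mem_mixedCube hx⟩,
    nonuniformlyComputable_connectedChoice_one⟩
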